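/- Consider the channel $y_k=S_ku_k+N_k$, $k=0,1,2,\dots$, where $\{N_k\}$ is i.i.d. standard Gaussian noise and $\{S_k\}$, independent of the noise, is a stationary, irreducible, aperiodic Markov chain with finitely many distinct real values $s[1],\dots,s[m]$, transition matrix $(p_{ij})$ and stationary distribution $(\pi[1],\dots,\pi[m])$. Let $d\in\{0,1\}$ and $\mathcal P\ge 0$. An $(M_K,K+1)$ code consists of $M_K$ equally likely messages (independent of the state and noise sequences), measurable encoding functions $u_k=u_k(W_K,y_0^{k-1},S_0^{k-d})$ for $k=0,\dots,K$ (noiseless output feedback with one-step delay; channel state information at the transmitter that is instantaneous for $d=0$ and delayed by one step for $d=1$), subject to $\frac1{K+1}\sum_{k=0}^K\mathbb E\,u_k^2\le\mathcal P$, and a measurable decoding function $\hat W_K=\hat W_K(y_0^K,S_0^K)$. A rate $R$ is achievable if there is a sequence of $(M_K,K+1)$ codes, $K=0,1,2,\dots$, such that $\liminf_{K\to\infty}\frac1{K+1}\log M_K\ge R$ and $\Pr(\hat W_K\ne W_K)\to0$. The operational capacity $C^o(\mathcal P)$ is the supremum of all achievable rates. The information capacity is $$C(\mathcal P)=\max_{\Pr(u|S_{-d})}\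 \mathbb E_{(S_{-d},S)}\, I(u;y\mid S_{-d},S),$$ where $y=Su+N$ with $N$ standard Gaussian, $S_{-d}$ has the stationary distribution and moves to $S$ in $d$ steps of the chain, the input $u$ depends on the states only through $S_{-d}$, $N$ is independent of $(u,S_{-d},S)$, and the maximum is over all conditional input distributions with $\mathbb E\,u^2\le\mathcal P$. Logarithms and mutual information are in nats. Then the maximum defining $C(\mathcal P)$ is attained, and $$C^o(\mathcal P)=C(\mathcal P)=\log\tilde a .$$ Here $\Gamma$ is any optimal power allocation, that is, any maximizer of $\gamma\mapsto\frac12\mathbb E\log\bigl(1+S^2\gamma(S_{-d})\bigr)$ over the functions $\gamma\ge0$ on the states with $\sum_j\pi[j]\gamma(s[j])\le\mathcal P$ (a maximizer exists), and $\tilde a=\prod_{j=1}^m\bar a[j]$ with $$\bar a[j]=\Bigl(\sqrt{1+s[j]^2\,\Gamma(s[j])}\Bigr)^{\pi[j]}\ \text{ if } d=0,\qquad \bar a[j]=\prod_{l=1}^m\Bigl(\sqrt{1+s[l]^2\,\Gamma(s[j])}\Bigr)^{\pi[j]p_{jl}}\ \text{ if } d=1.$$ -/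

import Mathlib

open MeasureTheory ProbabilityTheory InformationTheory Filter Topology
open scoped ENNReal NNReal

/-- Channel state information at the transmitter: instantaneous (`d = 0`) or with a one-step
delay (`d = 1`). -/
inductive CSI where
  | instantaneous
  | delayed

/-- The delay `d` of the state information at the transmitter. -/
def CSI.delay : CSI → ℕ
  | .instantaneous => 0
  | .delayed => 1

/-- The forward link: a Gaussian finite-state Markov channel `y_k = S_k u_k + N_k`. The state
process is a stationary, irreducible, aperiodic Markov chain on `m` states; state `i` has the real
gain `gain i`, and different states have different gains. -/
structure GaussianFSMC (m : ℕ) where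
  gain : Fin m → ℝ
  gain_injective : Function.Injective gain
  /-- the one-step transition matrix -/
  trans : Matrix (Fin m) (Fin m) ℝ
  stochastic : trans ∈ Matrix.rowStochastic ℝ (Fin m)
  irreducible : trans.IsIrreducible
  /-- the only common divisor of the possible return times to a state is `1` -/
  aperiodic : ∀ i : Fin m, ∀ r : ℕ, (∀ n : ℕ, 0 < n → 0 < (trans ^ n) i i → r ∣ n) → r = 1
  /-- the stationary distribution -/
  stat : Fin m → ℝ
  stat_nonneg : ∀ i, 0 ≤ stat i
  stat_sum : ∑ i, stat i = 1
  stationary : Matrix.vecMul stat trans = stat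

/-- A code with `M` messages and time span `0, …, K` for the channel with noiseless one-step
delayed output feedback. The channel input at time `k` is a function of the message, of the outputs
at the times `0, …, k - 1` and of the states at the times `0, …, k - d` (for `k = 0`, `d = 1` there
are none); the decoder sees all outputs and all states. -/
structure FeedbackCode (m : ℕ) (csi : CSI) (M K : ℕ) where
  enc : (k : Fin (K + 1)) → Fin M → (Fin k → ℝ) → (Fin (k + 1 - csi.delay) → Fin m) → ℝ
  measurable_enc : ∀ k w x, Measurable fun y => enc k w y x
  dec : (Fin (K + 1) → ℝ) → (Fin (K + 1) → Fin m) → Fin M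
  measurable_dec : ∀ x, Measurable fun y => dec y x

namespace GaussianFSMC

variable {m : ℕ} (F : GaussianFSMC m) {csi : CSI} {M K : ℕ}

/-- The law of the stationary state sequence `S_0, …, S_K`. -/
noncomputable def stateLaw (K : ℕ) : Measure (Fin (K + 1) → Fin m) :=
  ∑ x : Fin (K + 1) → Fin m,
    ENNReal.ofReal (F.stat (x 0) * ∏ k : Fin K, F.trans (x k.castSucc) (x k.succ)) •
      Measure.dirac x

/-- The joint law of the message, the state sequence and the noise sequence: independent, the
message being uniform on the `M` messages and the noise being i.i.d. standard Gaussian. -/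
noncomputable def law (M K : ℕ) :
    Measure (Fin M × (Fin (K + 1) → Fin m) × (Fin (K + 1) → ℝ)) :=
  (uniformOn Set.univ).prod
    ((F.stateLaw K).prod (Measure.pi fun _ => gaussianReal 0 1))

/-- The channel output `y_k` for message `w`, state sequence `x` and noise sequence `z`. -/
noncomputable def output (c : FeedbackCode m csi M K) (w : Fin M) (x : Fin (K + 1) → Fin m)
    (z : Fin (K + 1) → ℝ) (k : ℕ) (hk : k < K + 1) : ℝ :=
  F.gain (x ⟨k, hk⟩) *
      c.enc ⟨k, hk⟩ w (fun i => output c w x z i (i.2.trans hk))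
        (fun i => x ⟨i, lt_of_lt_of_le i.2 ((Nat.sub_le _ _).trans hk)⟩)
    + z ⟨k, hk⟩
termination_by k
decreasing_by exact i.2

/-- The channel input `u_k` for message `w`, state sequence `x` and noise sequence `z`. -/
noncomputable def input (c : FeedbackCode m csi M K) (w : Fin M) (x : Fin (K + 1) → Fin m)
    (z : Fin (K + 1) → ℝ) (k : Fin (K + 1)) : ℝ :=
  c.enc k w (fun i => F.output c w x z i (i.2.trans k.2))
    (fun i => x ⟨i, lt_of_lt_of_le i.2 ((Nat.sub_le _ _).trans k.2)⟩)

/-- The average power constraint `(1 / (K + 1)) ∑_{k=0}^K E (u_k)² ≤ P`. -/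
def PowerConstraint (c : FeedbackCode m csi M K) (P : ℝ) : Prop :=
  (∑ k : Fin (K + 1), ∫⁻ ω, ENNReal.ofReal (F.input c ω.1 ω.2.1 ω.2.2 k ^ 2) ∂(F.law M K))
    / ((K + 1 : ℕ) : ℝ≥0∞) ≤ ENNReal.ofReal P

/-- The probability that the decoded message differs from the selected one. -/
noncomputable def errorProb (c : FeedbackCode m csi M K) : ℝ≥0∞ :=
  F.law M K {ω | c.dec (fun k => F.output c ω.1 ω.2.1 ω.2.2 k k.2) ω.2.1 ≠ ω.1}

/-- The rate `R` is achievable with power budget `P`: some sequence of codes, one for each time span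
`0, …, K`, obeys the power constraint, has `liminf (log M_K) / (K + 1) ≥ R`, and has error
probability tending to `0`. -/
def Achievable (csi : CSI) (P R : ℝ) : Prop :=
  ∃ (M : ℕ → ℕ) (c : (K : ℕ) → FeedbackCode m csi (M K) K),
    (∀ K, F.PowerConstraint (c K) P) ∧
    (R : EReal) ≤ liminf (fun K : ℕ => ((Real.log (M K) / ((K : ℝ) + 1) : ℝ) : EReal)) atTop ∧
    Tendsto (fun K => F.errorProb (c K)) atTop (𝓝 0)

/-- The operational capacity: the supremum of the achievable rates. -/
noncomputable def operationalCapacity (csi : CSI) (P : ℝ) : EReal :=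
  sSup ((fun R : ℝ => (R : EReal)) '' {R | F.Achievable csi P R})

/-- The joint probability of `S_{-d} = i` and `S = j`, where `S_{-d}` has the stationary
distribution and moves to `S` in `d` steps of the chain. -/
noncomputable def pairProb (csi : CSI) (i j : Fin m) : ℝ :=
  F.stat i * (F.trans ^ csi.delay) i j

end GaussianFSMC

/-- The mutual information (in nats) of a pair with joint law `ρ`: the Kullback-Leibler divergence
of `ρ` from the product of its marginals. -/
noncomputable def mutualInformation (ρ : Measure (ℝ × ℝ)) : ℝ≥0∞ :=
  klDiv ρ (ρ.fst.prod ρ.snd)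

/-- The joint law of `(u, s u + N)` where `u` has law `κ` and `N` is standard Gaussian and
independent of `u`. -/
noncomputable def inputOutputLaw (s : ℝ) (κ : Measure ℝ) : Measure (ℝ × ℝ) :=
  (κ.prod (gaussianReal 0 1)).map fun p => (p.1, s * p.1 + p.2)

namespace GaussianFSMC

variable {m : ℕ} (F : GaussianFSMC m)

/-- The values `E I(u; y | S_{-d}, S)` over all conditional input laws `κ i = Pr(u | S_{-d} = i)`
with `E u² ≤ P`. -/
def informationRates (csi : CSI) (P : ℝ) : Set ℝ≥0∞ :=
  {I | ∃ κ : Fin m → ProbabilityMeasure ℝ,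
    ∑ i, ENNReal.ofReal (F.stat i) * ∫⁻ u, ENNReal.ofReal (u ^ 2) ∂(κ i : Measure ℝ)
        ≤ ENNReal.ofReal P ∧
    I = ∑ i, ∑ j, ENNReal.ofReal (F.pairProb csi i j) *
        mutualInformation (inputOutputLaw (F.gain j) (κ i))}

/-- The information capacity, as a supremum. -/
noncomputable def informationCapacity (csi : CSI) (P : ℝ) : ℝ≥0∞ :=
  sSup (F.informationRates csi P)

/-- The power allocations `γ` over the states with average power at most `P`. -/
def powerAllocations (P : ℝ) : Set (Fin m → ℝ) :=
  {γ | (∀ i, 0 ≤ γ i) ∧ ∑ i, F.stat i * γ i ≤ P}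

/-- `(1 / 2) E log (1 + S² γ(S_{-d}))`. -/
noncomputable def allocationRate (csi : CSI) (γ : Fin m → ℝ) : ℝ :=
  1 / 2 * ∑ i, ∑ j, F.pairProb csi i j * Real.log (1 + F.gain j ^ 2 * γ i)

/-- `Γ` is an optimal power allocation. -/
def IsOptimalAllocation (csi : CSI) (P : ℝ) (Γ : Fin m → ℝ) : Prop :=
  Γ ∈ F.powerAllocations P ∧ IsMaxOn (F.allocationRate csi) (F.powerAllocations P) Γ

/-- `ā[j]`: it is `a(s[j]) ^ π[j]` with `a(s[j]) = √(1 + s[j]² Γ(s[j]))` for instantaneous state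
information, and `∏_l a(s[j], s[l]) ^ (π[j] p_{jl})` with `a(s[j], s[l]) = √(1 + s[l]² Γ(s[j]))`
for delayed state information. -/
noncomputable def aBar (Γ : Fin m → ℝ) : CSI → Fin m → ℝ
  | .instantaneous, j => √(1 + F.gain j ^ 2 * Γ j) ^ F.stat j
  | .delayed, j => ∏ l, √(1 + F.gain l ^ 2 * Γ j) ^ (F.stat j * F.trans j l)

/-- `ã = ∏_j ā[j]`. -/
noncomputable def aTilde (csi : CSI) (Γ : Fin m → ℝ) : ℝ :=
  ∏ j, F.aBar Γ csi j

end GaussianFSMC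

/-! Both capacities are compared with the concave problem of maximizing `allocationRate` over power
allocations. At a maximizer Γ the directional derivatives towards feasible allocations are
nonpositive. Writing Λ for the stationary mean of `marginalGain` times Γ, this yields a multiplier l
that bounds every `marginalGain` and satisfies l P ≤ Λ (`IsOptimalAllocation.sum_marginalGain_le`,
`IsOptimalAllocation.exists_multiplier`).

Information capacity. Mutual information is at most the divergence from the input law times any
fixed output law (`klDiv_prod_marginals_le`). Taking N(0, 1 + S²Γ(S_{-d})) as that output law gives
a bound that is affine in the conditional input powers, so first-order optimality of Γ bounds its
mean by the rate of Γ. Gaussian inputs of variance Γ attain it.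

Converse. The same reference output law works with feedback. For a fixed state path, weighting by
the inverse likelihood ratio turns the outputs, whatever the message, into the same independent
Gaussians, because each input is determined by the earlier outputs (`lintegral_exp_neg_sum_output`).
Under that common law the decoding regions have total mass one, which gives a Fano-type bound
(`sum_correct_mul_log_le`). The expected log-likelihood ratio involves only input powers. Averaging
over paths with the Markov property and using l leaves (K + 1) times the rate of Γ plus O(log K)
(`PowerConstraint.log_le`).

Achievability. In the Schalkwijk–Kailath scheme the transmitter sends the scaled error of the
receiver's linear estimate of w / M, and each use divides the bound on the squared error by 1 +
S²Γ(S_{-d}). The logarithm of the final bound is, up to one harmless term, an additive functional of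
the chain. Solving the Poisson equation bounds its variance linearly
(`exists_additive_functional_sq_le`), so Chebyshev's inequality shows that it concentrates around
its mean, and the error probability vanishes at every rate below that of Γ. -/

namespace GaussianFSMC

variable {m : ℕ} (F : GaussianFSMC m)

/-! ### Finite Markov chains: Poisson equation, path probabilities, variance of additive functionals
-/

lemma trans_nonneg (i j : Fin m) : 0 ≤ F.trans i j := F.stochastic.1 i j

lemma sum_trans (i : Fin m) : ∑ j, F.trans i j = 1 :=
  Matrix.sum_row_of_mem_rowStochastic F.stochastic i

lemma sum_stat_mul_trans (j : Fin m) : ∑ i, F.stat i * F.trans i j = F.stat j :=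
  congrFun F.stationary j

lemma vecMul_stat_pow (n : ℕ) : Matrix.vecMul F.stat (F.trans ^ n) = F.stat := by
  induction n with
  | zero => simp
  | succ n ih => rw [pow_succ, ← Matrix.vecMul_vecMul, ih, F.stationary]

lemma sum_trans_pow_delay (csi : CSI) (i : Fin m) : ∑ j, (F.trans ^ csi.delay) i j = 1 :=
  Matrix.sum_row_of_mem_rowStochastic (pow_mem F.stochastic _) i

lemma pairProb_nonneg (csi : CSI) (i j : Fin m) : 0 ≤ F.pairProb csi i j :=
  mul_nonneg (F.stat_nonneg i) ((pow_mem F.stochastic _).1 i j)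

/-- An irreducible chain charges every state. -/
lemma stat_pos (j : Fin m) : 0 < F.stat j := by
  obtain ⟨i, hi⟩ : ∃ i, 0 < F.stat i := by
    by_contra! h
    have := F.stat_sum
    rw [Finset.sum_eq_zero fun i _ => le_antisymm (h i) (F.stat_nonneg i)] at this
    exact zero_ne_one this
  obtain ⟨k, -, hk⟩ :=
    (Matrix.isIrreducible_iff_exists_pow_pos F.trans_nonneg).1 F.irreducible i j
  -- Stationarity under the k-step kernel: the mass of `j` is at least what flows into it from the
  -- charged state `i`.
  rw [← congrFun (F.vecMul_stat_pow k) j]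
  refine (mul_pos hi hk).trans_le ?_
  exact Finset.single_le_sum (f := fun i => F.stat i * (F.trans ^ k) i j)
    (fun l _ => mul_nonneg (F.stat_nonneg l) ((pow_mem F.stochastic k).1 l j)) (Finset.mem_univ i)

lemma nonempty_states (F : GaussianFSMC m) : Nonempty (Fin m) := by
  by_contra h
  rw [not_nonempty_iff] at h
  simpa using F.stat_sum

/-- The harmonic functions of an irreducible chain are constant. -/
lemma harmonic_const (h : Fin m → ℝ) (hh : F.trans.mulVec h = h) (i j : Fin m) : h i = h j := by
  have := F.nonempty_states
  obtain ⟨l, hl⟩ := Finite.exists_max h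
  have hpow : ∀ n, (F.trans ^ n).mulVec h = h := by
    intro n
    induction n with
    | zero => simp
    | succ n ih => rw [pow_succ, ← Matrix.mulVec_mulVec, hh, ih]
  have key : ∀ i, h i = h l := by
    intro i
    obtain ⟨k, -, hk⟩ :=
      (Matrix.isIrreducible_iff_exists_pow_pos F.trans_nonneg).1 F.irreducible l i
    have h1 : ∑ j, (F.trans ^ k) l j * (h l - h j) = 0 := by
      have h2 : ∑ j, (F.trans ^ k) l j * h j = h l := congrFun (hpow k) l
      have h3 := Matrix.sum_row_of_mem_rowStochastic (pow_mem F.stochastic k) l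
      simp only [mul_sub, Finset.sum_sub_distrib, h2, ← Finset.sum_mul, h3]
      ring
    have h4 := (Finset.sum_eq_zero_iff_of_nonneg fun j _ =>
      mul_nonneg ((pow_mem F.stochastic k).1 l j) (sub_nonneg.2 (hl j))).1 h1 i (Finset.mem_univ i)
    rcases mul_eq_zero.1 h4 with h5 | h5
    · exact absurd h5 hk.ne'
    · linarith
  rw [key i, key j]

/-- The Poisson equation of an irreducible chain is solvable for every centred function. -/
lemma exists_poisson (f : Fin m → ℝ) (hf : ∑ i, F.stat i * f i = 0) :
    ∃ h : Fin m → ℝ, ∀ i, h i - ∑ j, F.trans i j * h j = f i := by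
  have := F.nonempty_states
  let T : (Fin m → ℝ) →ₗ[ℝ] (Fin m → ℝ) := LinearMap.id - F.trans.mulVecLin
  let φ : (Fin m → ℝ) →ₗ[ℝ] ℝ := ∑ i, F.stat i • LinearMap.proj i
  have hφ : ∀ g, φ g = ∑ i, F.stat i * g i := by intro g; simp [φ]
  have hT : ∀ g i, T g i = g i - ∑ j, F.trans i j * g j := by
    intro g i; simp [T, Matrix.mulVec, dotProduct]
  -- Stationarity gives one inclusion. The other is a dimension count: the kernel of `T` consists of
  -- harmonic functions, hence of constants, so the range has codimension at most one.
  have hle : LinearMap.range T ≤ LinearMap.ker φ := by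
    rintro _ ⟨g, rfl⟩
    rw [LinearMap.mem_ker, hφ]
    simp only [hT, mul_sub, Finset.sum_sub_distrib, Finset.mul_sum]
    rw [Finset.sum_comm (f := fun i j => F.stat i * (F.trans i j * g j))]
    simp only [← mul_assoc, ← Finset.sum_mul, F.sum_stat_mul_trans, sub_self]
  have hker : Module.finrank ℝ (LinearMap.ker T) ≤ 1 := by
    refine finrank_le_one (⟨fun _ => 1, ?_⟩ : LinearMap.ker T) ?_
    · rw [LinearMap.mem_ker]; ext i; simp [hT, F.sum_trans]
    · rintro ⟨g, hg⟩
      have hg' : F.trans.mulVec g = g := by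
        ext i
        have := congrFun (LinearMap.mem_ker.1 hg) i
        rw [hT] at this
        simp only [Pi.zero_apply] at this
        simp only [Matrix.mulVec, dotProduct]
        linarith
      refine ⟨g (Classical.arbitrary _), ?_⟩
      ext i
      simpa using F.harmonic_const g hg' _ _
  have hsurj : LinearMap.range φ = ⊤ := by
    rw [LinearMap.range_eq_top]
    intro c
    refine ⟨fun _ => c, ?_⟩
    rw [hφ, ← Finset.sum_mul, F.stat_sum, one_mul]
  have h1 := LinearMap.finrank_range_add_finrank_ker T
  have h2 := LinearMap.finrank_range_add_finrank_ker φ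
  rw [hsurj, finrank_top, Module.finrank_self] at h2
  have heq : LinearMap.range T = LinearMap.ker φ :=
    Submodule.eq_of_le_of_finrank_le hle (by omega)
  have hmem : f ∈ LinearMap.range T := by rw [heq, LinearMap.mem_ker, hφ, hf]
  obtain ⟨h, rfl⟩ := hmem
  exact ⟨h, fun i => (hT h i).symm⟩

/-- The probability of the state path `x`. -/
noncomputable def pathProb (n : ℕ) (x : Fin (n + 1) → Fin m) : ℝ :=
  F.stat (x 0) * ∏ k : Fin n, F.trans (x k.castSucc) (x k.succ)

lemma pathProb_nonneg (n : ℕ) (x : Fin (n + 1) → Fin m) : 0 ≤ F.pathProb n x :=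
  mul_nonneg (F.stat_nonneg _) (Finset.prod_nonneg fun _ _ => F.trans_nonneg _ _)

lemma pathProb_snoc (n : ℕ) (x : Fin (n + 1) → Fin m) (j : Fin m) :
    F.pathProb (n + 1) (Fin.snoc x j) = F.pathProb n x * F.trans (x (Fin.last n)) j := by
  simp only [pathProb, Fin.prod_univ_castSucc (n := n), mul_assoc]
  congr 1
  congr 1
  · refine Finset.prod_congr rfl fun k _ => ?_
    rw [Fin.snoc_castSucc (α := fun _ => Fin m), Fin.succ_castSucc,
      Fin.snoc_castSucc (α := fun _ => Fin m)]
  · rw [Fin.snoc_castSucc (α := fun _ => Fin m), Fin.succ_last, Fin.snoc_last]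

lemma sum_path_succ {R : Type*} [AddCommMonoid R] (n : ℕ) (G : (Fin (n + 2) → Fin m) → R) :
    ∑ x, G x = ∑ x : Fin (n + 1) → Fin m, ∑ j, G (Fin.snoc x j) := by
  rw [← Fintype.sum_prod_type', ← (Equiv.prodComm _ _).sum_comp,
    ← (Fin.snocEquiv fun _ : Fin (n + 2) => Fin m).sum_comp]
  rfl

/-- The law of an initial segment of the path. -/
lemma sum_pathProb_init (n : ℕ) (G : (Fin (n + 1) → Fin m) → ℝ) :
    ∑ x, F.pathProb (n + 1) x * G (Fin.init x) = ∑ x, F.pathProb n x * G x := by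
  rw [sum_path_succ]
  refine Finset.sum_congr rfl fun x _ => ?_
  simp only [pathProb_snoc, Fin.init_snoc, ← Finset.sum_mul, ← Finset.mul_sum, F.sum_trans, mul_one]

/-- The Markov property: averaging over the next state, given the past. -/
lemma sum_pathProb_markov (n k : ℕ) (hk : k < n) (G : (Fin (n + 1) → Fin m) → ℝ)
    (hG : ∀ x x' : Fin (n + 1) → Fin m, (∀ i : Fin (n + 1), (i : ℕ) ≤ k → x i = x' i) → G x = G x')
    (A : Fin m → Fin m → ℝ) :
    ∑ x, F.pathProb n x * (G x * A (x ⟨k, by omega⟩) (x ⟨k + 1, by omega⟩)) =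
      ∑ x, F.pathProb n x * (G x * ∑ j, F.trans (x ⟨k, by omega⟩) j * A (x ⟨k, by omega⟩) j) := by
  obtain ⟨i₀⟩ := F.nonempty_states
  induction n with
  | zero => omega
  | succ n ih =>
    -- `G` does not read the last state, so it may be overwritten by the arbitrary `i₀`; this makes
    -- `G` a function of the initial segment.
    have hG' : ∀ x : Fin (n + 2) → Fin m, G x = G (Fin.snoc (Fin.init x) i₀) := by
      intro x
      refine hG _ _ fun i hi => ?_
      have : i = Fin.castSucc ⟨i, by omega⟩ := rfl
      rw [this, Fin.snoc_castSucc (α := fun _ => Fin m)]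
      rfl
    rcases Nat.lt_succ_iff_lt_or_eq.1 hk with h | rfl
    · have key := ih h (fun x => G (Fin.snoc x i₀)) (by
        intro x x' hx
        refine hG _ _ fun i hi => ?_
        have : i = Fin.castSucc ⟨i, by omega⟩ := rfl
        rw [this, Fin.snoc_castSucc (α := fun _ => Fin m), Fin.snoc_castSucc (α := fun _ => Fin m)]
        exact hx _ hi)
      rw [← F.sum_pathProb_init n, ← F.sum_pathProb_init n] at key
      simp only [← hG'] at key
      exact key
    · rw [sum_path_succ, sum_path_succ]
      refine Finset.sum_congr rfl fun x _ => ?_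
      have e1 : ∀ j, (Fin.snoc x j : Fin (k + 2) → Fin m) ⟨k, by omega⟩ = x (Fin.last k) :=
        fun j => Fin.snoc_castSucc (α := fun _ => Fin m) (p := x) (x := j) (i := Fin.last k)
      have e2 : ∀ j, (Fin.snoc x j : Fin (k + 2) → Fin m) ⟨k + 1, by omega⟩ = j :=
        fun j => Fin.snoc_last (α := fun _ => Fin m) (p := x) (x := j)
      have e3 : ∀ j, G (Fin.snoc x j) = G (Fin.snoc x i₀) := by
        intro j; rw [hG', Fin.init_snoc]
      simp only [pathProb_snoc, e1, e2, e3]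
      rw [← Finset.sum_mul, ← Finset.mul_sum, F.sum_trans, mul_one, Finset.mul_sum, Finset.mul_sum]
      refine Finset.sum_congr rfl fun j _ => ?_
      ring

/-- Each state of a stationary path has the stationary law. -/
lemma sum_pathProb_apply (n : ℕ) (k : Fin (n + 1)) (f : Fin m → ℝ) :
    ∑ x, F.pathProb n x * f (x k) = ∑ i, F.stat i * f i := by
  induction n generalizing f with
  | zero =>
    obtain rfl : k = 0 := Subsingleton.elim (α := Fin 1) _ _
    rw [← (Equiv.funUnique (Fin 1) (Fin m)).symm.sum_comp]
    simp [pathProb]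
  | succ n ih =>
    rcases k.eq_castSucc_or_eq_last with ⟨k, rfl⟩ | rfl
    · rw [← ih k f, ← F.sum_pathProb_init n]
      rfl
    · rw [sum_path_succ]
      simp only [pathProb_snoc, Fin.snoc_last, mul_assoc]
      simp only [← Finset.mul_sum]
      rw [ih (Fin.last n) fun i => ∑ j, F.trans i j * f j]
      simp only [Finset.mul_sum]
      rw [Finset.sum_comm]
      refine Finset.sum_congr rfl fun j _ => ?_
      rw [← F.sum_stat_mul_trans j, Finset.sum_mul]
      simp only [mul_assoc]

lemma sum_pathProb (n : ℕ) : ∑ x, F.pathProb n x = 1 := by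
  simpa [F.stat_sum] using F.sum_pathProb_apply n 0 fun _ => 1

lemma sum_fin_succ_sub (n : ℕ) (f : Fin (n + 1) → ℝ) :
    ∑ k : Fin n, (f k.succ - f k.castSucc) = f (Fin.last n) - f 0 := by
  have h := (Fin.sum_univ_castSucc f).symm.trans (Fin.sum_univ_succ f)
  rw [Finset.sum_sub_distrib]
  linarith

/-- Sums of martingale differences have linearly growing second moments. -/
lemma sum_pathProb_martingale_sq_le (φ : Fin m → Fin m → ℝ)
    (hφ : ∀ i, ∑ j, F.trans i j * φ i j = 0) (n : ℕ) :
    ∑ x, F.pathProb n x * (∑ k : Fin n, φ (x k.castSucc) (x k.succ)) ^ 2 ≤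
      n * ∑ i, F.stat i * ∑ j, F.trans i j * φ i j ^ 2 := by
  induction n with
  | zero => simp
  | succ n ih =>
    rw [sum_path_succ]
    have key : ∀ x : Fin (n + 1) → Fin m,
        ∑ j, F.pathProb (n + 1) (Fin.snoc x j) * (∑ k : Fin (n + 1),
          φ ((Fin.snoc x j : Fin (n + 2) → Fin m) k.castSucc)
            ((Fin.snoc x j : Fin (n + 2) → Fin m) k.succ)) ^ 2 =
        F.pathProb n x * (∑ k : Fin n, φ (x k.castSucc) (x k.succ)) ^ 2 +
          F.pathProb n x * ∑ j, F.trans (x (Fin.last n)) j * φ (x (Fin.last n)) j ^ 2 := by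
      intro x
      simp only [Fin.sum_univ_castSucc (n := n), Fin.snoc_castSucc (α := fun _ => Fin m),
        Fin.succ_castSucc, Fin.succ_last, Fin.snoc_last, pathProb_snoc]
      set S := ∑ k : Fin n, φ (x k.castSucc) (x k.succ)
      set l := x (Fin.last n)
      -- The cross term is linear in `φ l j` and has conditional mean zero; only the squares
      -- accumulate.
      have : ∀ j, F.pathProb n x * F.trans l j * (S + φ l j) ^ 2 =
          F.pathProb n x * S ^ 2 * F.trans l j + 2 * F.pathProb n x * S * (F.trans l j * φ l j) +
            F.pathProb n x * (F.trans l j * φ l j ^ 2) := fun j => by ring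
      simp only [this, Finset.sum_add_distrib, ← Finset.mul_sum, F.sum_trans, hφ]
      ring
    simp only [key, Finset.sum_add_distrib]
    rw [F.sum_pathProb_apply n (Fin.last n) fun i => ∑ j, F.trans i j * φ i j ^ 2]
    push_cast
    linarith

/-- The variance of an additive functional of the chain grows at most linearly. -/
lemma exists_additive_functional_sq_le (g : Fin m → Fin m → ℝ) :
    ∃ A : ℝ, 0 ≤ A ∧ ∀ n : ℕ, ∑ x, F.pathProb n x *
      (∑ k : Fin n, (g (x k.castSucc) (x k.succ) -
        ∑ i, F.stat i * ∑ j, F.trans i j * g i j)) ^ 2 ≤ A * (n + 1) := by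
  set c := ∑ i, F.stat i * ∑ j, F.trans i j * g i j with hc
  obtain ⟨h, hh⟩ := F.exists_poisson (fun i => (∑ j, F.trans i j * g i j) - c) (by
    simp only [mul_sub, Finset.sum_sub_distrib, ← Finset.sum_mul, F.stat_sum, one_mul, ← hc,
      sub_self])
  -- By the Poisson equation, adding the increment of `h` turns the centred functional into
  -- martingale differences; the correction telescopes to boundary terms.
  let φ : Fin m → Fin m → ℝ := fun i j => g i j - c + h j - h i
  have hφ : ∀ i, ∑ j, F.trans i j * φ i j = 0 := by
    intro i
    have := hh i
    simp only [φ, mul_add, mul_sub, Finset.sum_add_distrib, Finset.sum_sub_distrib,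
      ← Finset.sum_mul, F.sum_trans]
    linarith
  set B := ∑ i, F.stat i * ∑ j, F.trans i j * φ i j ^ 2
  have hB : 0 ≤ B := Finset.sum_nonneg fun i _ => mul_nonneg (F.stat_nonneg i)
    (Finset.sum_nonneg fun j _ => mul_nonneg (F.trans_nonneg i j) (sq_nonneg _))
  set D := ∑ i, h i ^ 2
  have hD0 : 0 ≤ D := Finset.sum_nonneg fun i _ => sq_nonneg _
  have hD : ∀ i, h i ^ 2 ≤ D := fun i =>
    Finset.single_le_sum (f := fun i => h i ^ 2) (fun i _ => sq_nonneg _) (Finset.mem_univ i)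
  -- From (a + b)² ≤ 2a² + 2b², where the boundary term satisfies b² ≤ 2 h(x 0)² + 2 h(x n)² ≤ 4 D.
  refine ⟨2 * B + 8 * D, by positivity, fun n => ?_⟩
  have tele : ∀ x : Fin (n + 1) → Fin m,
      ∑ k : Fin n, (g (x k.castSucc) (x k.succ) - c) =
        ∑ k : Fin n, φ (x k.castSucc) (x k.succ) + (h (x 0) - h (x (Fin.last n))) := by
    intro x
    have : ∑ k : Fin n, (h (x k.succ) - h (x k.castSucc)) = h (x (Fin.last n)) - h (x 0) :=
      sum_fin_succ_sub n (fun k => h (x k))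
    simp only [φ, add_sub_assoc, Finset.sum_add_distrib, this]
    ring
  calc _ ≤ ∑ x, F.pathProb n x * (2 * (∑ k : Fin n, φ (x k.castSucc) (x k.succ)) ^ 2 + 8 * D) := by
        refine Finset.sum_le_sum fun x _ => mul_le_mul_of_nonneg_left ?_ (F.pathProb_nonneg n x)
        rw [tele]
        have h1 := hD (x 0)
        have h2 := hD (x (Fin.last n))
        nlinarith [sq_nonneg (∑ k : Fin n, φ (x k.castSucc) (x k.succ) -
          (h (x 0) - h (x (Fin.last n)))), sq_nonneg (h (x 0) + h (x (Fin.last n)))]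
    _ = 2 * ∑ x, F.pathProb n x * (∑ k : Fin n, φ (x k.castSucc) (x k.succ)) ^ 2 + 8 * D := by
        simp only [mul_add, Finset.sum_add_distrib, ← Finset.sum_mul, F.sum_pathProb, one_mul,
          Finset.mul_sum]
        congr 1
        exact Finset.sum_congr rfl fun x _ => by ring
    _ ≤ 2 * (n * B) + 8 * D := by
        have := F.sum_pathProb_martingale_sq_le φ hφ n
        linarith
    _ ≤ _ := by
        have : (0 : ℝ) ≤ n := n.cast_nonneg
        nlinarith [mul_nonneg this hD0]

end GaussianFSMC

/-! ### Optimal power allocations and their first-order conditions -/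

namespace GaussianFSMC

variable {m : ℕ} (F : GaussianFSMC m)

lemma log_aTilde (csi : CSI) (Γ : Fin m → ℝ) (hΓ : ∀ i, 0 ≤ Γ i) :
    Real.log (F.aTilde csi Γ) = F.allocationRate csi Γ := by
  have hpos : ∀ i j, 0 < 1 + F.gain j ^ 2 * Γ i := fun i j => by
    have := mul_nonneg (sq_nonneg (F.gain j)) (hΓ i); linarith
  have hs : ∀ i j (p : ℝ), 0 < √(1 + F.gain j ^ 2 * Γ i) ^ p := fun i j p =>
    Real.rpow_pos_of_pos (Real.sqrt_pos.2 (hpos i j)) p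
  have hl : ∀ i j (p : ℝ), Real.log (√(1 + F.gain j ^ 2 * Γ i) ^ p) =
      1 / 2 * (p * Real.log (1 + F.gain j ^ 2 * Γ i)) := fun i j p => by
    rw [Real.log_rpow (Real.sqrt_pos.2 (hpos i j)), Real.log_sqrt (hpos i j).le]; ring
  cases csi with
  | instantaneous =>
    simp only [aTilde, aBar, allocationRate, pairProb, CSI.delay, pow_zero]
    rw [Real.log_prod fun i _ => (hs i i _).ne']
    simp only [hl, ← Finset.mul_sum]
    congr 1
    refine Finset.sum_congr rfl fun i _ => ?_
    rw [Finset.sum_eq_single i]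
    · simp
    · intro j _ hj; simp [Matrix.one_apply_ne' hj]
    · simp
  | delayed =>
    simp only [aTilde, aBar, allocationRate, pairProb, CSI.delay, pow_one]
    rw [Real.log_prod fun i _ => (Finset.prod_pos fun j _ => hs i j _).ne']
    simp only [Finset.mul_sum]
    refine Finset.sum_congr rfl fun i _ => ?_
    rw [Real.log_prod fun j _ => (hs i j _).ne']
    simp only [hl]

lemma zero_mem_powerAllocations {P : ℝ} (hP : 0 ≤ P) : (fun _ => 0) ∈ F.powerAllocations P := by
  simp [powerAllocations, hP]

/-- Boundedness rests on every state having positive stationary mass: the budget then caps each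
coordinate at `P / F.stat i`. -/
lemma isCompact_powerAllocations (P : ℝ) : IsCompact (F.powerAllocations P) := by
  refine Metric.isCompact_of_isClosed_isBounded ?_ ?_
  · have : F.powerAllocations P = Set.Ici 0 ∩ {γ | ∑ i, F.stat i * γ i ≤ P} := rfl
    rw [this]
    exact isClosed_Ici.inter (isClosed_le (by fun_prop) continuous_const)
  · refine (Metric.isBounded_Icc (0 : Fin m → ℝ) fun i => P / F.stat i).subset ?_
    rintro γ ⟨h0, h1⟩
    refine ⟨h0, fun i => ?_⟩
    rw [le_div_iff₀ (F.stat_pos i), mul_comm]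
    exact (Finset.single_le_sum (f := fun i => F.stat i * γ i)
      (fun j _ => mul_nonneg (F.stat_nonneg j) (h0 j)) (Finset.mem_univ i)).trans h1

lemma convex_powerAllocations (P : ℝ) : Convex ℝ (F.powerAllocations P) := by
  rintro γ ⟨h0, h1⟩ γ' ⟨h0', h1'⟩ a b ha hb hab
  refine ⟨fun i => ?_, ?_⟩
  · have := mul_nonneg ha (h0 i)
    have := mul_nonneg hb (h0' i)
    simp only [Pi.add_apply, Pi.smul_apply, smul_eq_mul]
    linarith
  · have : ∑ i, F.stat i * (a • γ + b • γ') i =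
        a * ∑ i, F.stat i * γ i + b * ∑ i, F.stat i * γ' i := by
      rw [Finset.mul_sum, Finset.mul_sum, ← Finset.sum_add_distrib]
      refine Finset.sum_congr rfl fun i _ => ?_
      simp only [Pi.add_apply, Pi.smul_apply, smul_eq_mul]
      ring
    rw [this]
    calc _ ≤ a * P + b * P := by gcongr
      _ = P := by rw [← add_mul, hab, one_mul]

lemma exists_isOptimalAllocation (csi : CSI) {P : ℝ} (hP : 0 ≤ P) :
    ∃ Γ, F.IsOptimalAllocation csi P Γ := by
  refine (F.isCompact_powerAllocations P).exists_isMaxOn ⟨_, F.zero_mem_powerAllocations hP⟩ ?_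
  unfold allocationRate
  refine continuousOn_const.mul (continuousOn_finsetSum _ fun i _ =>
    continuousOn_finsetSum _ fun j _ => continuousOn_const.mul ?_)
  refine ContinuousOn.log (by fun_prop) fun γ hγ => ?_
  have := mul_nonneg (sq_nonneg (F.gain j)) (hγ.1 i)
  positivity

/-- The mean of `S² / (1 + S² γ)`, given that `S_{-d} = i`. -/
noncomputable def marginalGain (csi : CSI) (γ : Fin m → ℝ) (i : Fin m) : ℝ :=
  ∑ j, (F.trans ^ csi.delay) i j * (F.gain j ^ 2 / (1 + F.gain j ^ 2 * γ i))

lemma marginalGain_nonneg (csi : CSI) {γ : Fin m → ℝ} (hγ : ∀ i, 0 ≤ γ i) (i : Fin m) :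
    0 ≤ F.marginalGain csi γ i := by
  refine Finset.sum_nonneg fun j _ => mul_nonneg ((pow_mem F.stochastic _).1 i j) ?_
  have := mul_nonneg (sq_nonneg (F.gain j)) (hγ i)
  positivity

lemma stat_mul_marginalGain (csi : CSI) (γ : Fin m → ℝ) (i : Fin m) :
    F.stat i * F.marginalGain csi γ i =
      ∑ j, F.pairProb csi i j * (F.gain j ^ 2 / (1 + F.gain j ^ 2 * γ i)) := by
  simp only [marginalGain, pairProb, Finset.mul_sum, mul_assoc]

lemma allocationRate_nonneg (csi : CSI) {γ : Fin m → ℝ} (hγ : ∀ i, 0 ≤ γ i) :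
    0 ≤ F.allocationRate csi γ := by
  refine mul_nonneg (by norm_num) (Finset.sum_nonneg fun i _ => Finset.sum_nonneg fun j _ =>
    mul_nonneg (F.pairProb_nonneg csi i j) (Real.log_nonneg ?_))
  have := mul_nonneg (sq_nonneg (F.gain j)) (hγ i)
  linarith

/-- The variational inequality satisfied by an optimal power allocation. -/
lemma IsOptimalAllocation.sum_marginalGain_le {csi : CSI} {P : ℝ} {Γ : Fin m → ℝ}
    (hΓ : F.IsOptimalAllocation csi P Γ) {γ : Fin m → ℝ} (hγ : γ ∈ F.powerAllocations P) :
    ∑ i, F.stat i * F.marginalGain csi Γ i * γ i ≤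
      ∑ i, F.stat i * F.marginalGain csi Γ i * Γ i := by
  have hpos : ∀ i j, 0 < 1 + F.gain j ^ 2 * Γ i := fun i j => by
    have := mul_nonneg (sq_nonneg (F.gain j)) (hΓ.1.1 i); linarith
  -- The rate along the segment from Γ to γ, feasible by convexity. It is largest at t = 0, so its
  -- derivative there, a limit of nonpositive right slopes, is nonpositive.
  let φ : ℝ → ℝ := fun t => F.allocationRate csi (Γ + t • (γ - Γ))
  have hder : HasDerivAt φ (1 / 2 * ∑ i, ∑ j, F.pairProb csi i j *
      ((F.gain j ^ 2 * (γ i - Γ i)) / (1 + F.gain j ^ 2 * Γ i))) 0 := by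
    refine HasDerivAt.const_mul _ (HasDerivAt.fun_sum fun i _ => HasDerivAt.fun_sum fun j _ =>
      HasDerivAt.const_mul _ ?_)
    have h1 : HasDerivAt (fun t : ℝ => 1 + F.gain j ^ 2 * (Γ + t • (γ - Γ)) i)
        (F.gain j ^ 2 * (γ i - Γ i)) 0 := by
      simp only [Pi.add_apply, Pi.smul_apply, smul_eq_mul, Pi.sub_apply]
      simpa using ((((hasDerivAt_id (0 : ℝ)).mul_const (γ i - Γ i)).const_add (Γ i)).const_mul
        (F.gain j ^ 2)).const_add 1
    have := h1.log (by simpa using (hpos i j).ne')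
    simpa using this
  have hle : 1 / 2 * ∑ i, ∑ j, F.pairProb csi i j *
      ((F.gain j ^ 2 * (γ i - Γ i)) / (1 + F.gain j ^ 2 * Γ i)) ≤ 0 := by
    have hs := (hasDerivAt_iff_tendsto_slope.1 hder).mono_left
      (nhdsWithin_mono 0 (fun t (ht : 0 < t) => ht.ne') : 𝓝[>] (0 : ℝ) ≤ _)
    refine le_of_tendsto hs ?_
    filter_upwards [Ioc_mem_nhdsGT (zero_lt_one (α := ℝ))] with t ht
    rw [slope_def_field]
    refine div_nonpos_of_nonpos_of_nonneg ?_ (by linarith [ht.1])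
    have hmem : Γ + t • (γ - Γ) ∈ F.powerAllocations P :=
      (F.convex_powerAllocations P).add_smul_sub_mem hΓ.1 hγ ⟨ht.1.le, ht.2⟩
    have := hΓ.2 hmem
    simp only [φ, zero_smul, add_zero]
    exact sub_nonpos.2 this
  have e : ∀ i, ∑ j, F.pairProb csi i j *
      ((F.gain j ^ 2 * (γ i - Γ i)) / (1 + F.gain j ^ 2 * Γ i)) =
      F.stat i * F.marginalGain csi Γ i * γ i - F.stat i * F.marginalGain csi Γ i * Γ i := by
    intro i
    rw [← mul_sub, stat_mul_marginalGain, Finset.sum_mul]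
    exact Finset.sum_congr rfl fun j _ => by ring
  simp only [e, Finset.sum_sub_distrib] at hle
  linarith

/-- A Lagrange multiplier for an optimal power allocation. -/
lemma IsOptimalAllocation.exists_multiplier {csi : CSI} {P : ℝ} (hP : 0 ≤ P) {Γ : Fin m → ℝ}
    (hΓ : F.IsOptimalAllocation csi P Γ) :
    ∃ l : ℝ, 0 ≤ l ∧ (∀ i, F.marginalGain csi Γ i ≤ l) ∧
      l * P ≤ ∑ i, F.stat i * F.marginalGain csi Γ i * Γ i := by
  have hL : 0 ≤ ∑ i, F.stat i * F.marginalGain csi Γ i * Γ i :=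
    Finset.sum_nonneg fun i _ => mul_nonneg (mul_nonneg (F.stat_nonneg i)
      (F.marginalGain_nonneg csi hΓ.1.1 i)) (hΓ.1.1 i)
  rcases hP.eq_or_lt with rfl | hP
  -- For zero budget the condition on `l * P` is void, and any upper bound of the marginal gains
  -- serves.
  · refine ⟨∑ i, F.marginalGain csi Γ i,
      Finset.sum_nonneg fun i _ => F.marginalGain_nonneg csi hΓ.1.1 i, fun i => ?_, by simpa⟩
    exact Finset.single_le_sum (f := F.marginalGain csi Γ)
      (fun i _ => F.marginalGain_nonneg csi hΓ.1.1 i) (Finset.mem_univ i)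
  · refine ⟨(∑ i, F.stat i * F.marginalGain csi Γ i * Γ i) / P, by positivity, fun i => ?_,
      (div_mul_cancel₀ _ hP.ne').le⟩
    rw [le_div_iff₀ hP]
    -- Testing optimality against the allocation that spends the whole budget in state `i` yields
    -- `F.marginalGain csi Γ i * P` at most the mean of marginal gain times Γ.
    have hmem : Pi.single i (P / F.stat i) ∈ F.powerAllocations P := by
      refine ⟨fun j => ?_, ?_⟩
      · by_cases h : j = i
        · subst h; simpa using div_nonneg hP.le (F.stat_nonneg j)
        · simp [h]
      · rw [Finset.sum_eq_single i (fun j _ h => by simp [h]) (by simp)]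
        simp [mul_div_cancel₀ _ (F.stat_pos i).ne']
    have := hΓ.sum_marginalGain_le F hmem
    rw [Finset.sum_eq_single i (fun j _ h => by simp [h]) (by simp), Pi.single_eq_same] at this
    refine le_of_eq_of_le ?_ this
    have := (F.stat_pos i).ne'
    field_simp

end GaussianFSMC

/-! ### Gaussian likelihood ratios, divergences and mutual information -/

/-- The log-likelihood ratio at `y` between `N(a, 1)` and `N(0, v)`. -/
noncomputable def gaussianLLR (v : ℝ≥0) (a y : ℝ) : ℝ :=
  1 / 2 * Real.log v + y ^ 2 / (2 * v) - (y - a) ^ 2 / 2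

@[fun_prop]
lemma measurable_gaussianLLR (v : ℝ≥0) : Measurable fun p : ℝ × ℝ => gaussianLLR v p.1 p.2 := by
  unfold gaussianLLR; fun_prop

lemma gaussianPDF_mul_exp_gaussianLLR {v : ℝ≥0} (hv : v ≠ 0) (a y : ℝ) :
    gaussianPDF 0 v y * ENNReal.ofReal (Real.exp (gaussianLLR v a y)) = gaussianPDF a 1 y := by
  have hv' : (0 : ℝ) < v := by positivity
  rw [gaussianPDF, gaussianPDF, ← ENNReal.ofReal_mul (gaussianPDFReal_nonneg _ _ _)]
  congr 1
  have h1 : Real.exp (1 / 2 * Real.log v) = √v := by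
    rw [Real.sqrt_eq_rpow, Real.rpow_def_of_pos hv', mul_comm]
  simp only [gaussianPDFReal, gaussianLLR, NNReal.coe_one, mul_one, sub_zero]
  rw [add_sub_assoc, Real.exp_add, h1, Real.sqrt_mul (by positivity)]
  have h2 : √(v : ℝ) ≠ 0 := (Real.sqrt_pos.2 hv').ne'
  have h3 : Real.exp (-(y - a) ^ 2 / 2) =
      Real.exp (-y ^ 2 / (2 * v)) * Real.exp (y ^ 2 / (2 * v) - (y - a) ^ 2 / 2) := by
    rw [← Real.exp_add]; congr 1; ring
  rw [h3]
  field_simp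

lemma lintegral_gaussianReal_add {v : ℝ≥0} (hv : v ≠ 0) (a : ℝ) {H : ℝ → ℝ≥0∞}
    (hH : Measurable H) :
    ∫⁻ z, H (a + z) ∂(gaussianReal 0 1) =
      ∫⁻ y, ENNReal.ofReal (Real.exp (gaussianLLR v a y)) * H y ∂(gaussianReal 0 v) := by
  have h1 : (gaussianReal 0 1).map (a + ·) = gaussianReal a 1 := by
    rw [gaussianReal_map_const_add, zero_add]
  have hm : Measurable fun y => ENNReal.ofReal (Real.exp (gaussianLLR v a y)) := by
    unfold gaussianLLR; fun_prop
  rw [← lintegral_map hH (measurable_const_add a), h1, gaussianReal_of_var_ne_zero _ one_ne_zero,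
    gaussianReal_of_var_ne_zero _ hv, lintegral_withDensity_eq_lintegral_mul _
      (measurable_gaussianPDF _ _) hH, lintegral_withDensity_eq_lintegral_mul _
      (measurable_gaussianPDF _ _) (g := fun y =>
        ENNReal.ofReal (Real.exp (gaussianLLR v a y)) * H y) (hm.mul hH)]
  refine lintegral_congr fun y => ?_
  simp only [Pi.mul_apply]
  rw [← mul_assoc, gaussianPDF_mul_exp_gaussianLLR hv]

/-- Change of measure from `N(a, 1)` to `N(0, v)`. -/
lemma lintegral_exp_neg_gaussianLLR {v : ℝ≥0} (hv : v ≠ 0) (a : ℝ) {H : ℝ → ℝ≥0∞}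
    (hH : Measurable H) :
    ∫⁻ z, ENNReal.ofReal (Real.exp (-gaussianLLR v a (a + z))) * H (a + z) ∂(gaussianReal 0 1) =
      ∫⁻ y, H y ∂(gaussianReal 0 v) := by
  have hm : Measurable fun y => ENNReal.ofReal (Real.exp (-gaussianLLR v a y)) * H y := by
    unfold gaussianLLR; fun_prop
  rw [lintegral_gaussianReal_add hv a hm]
  refine lintegral_congr fun y => ?_
  rw [← mul_assoc, ← ENNReal.ofReal_mul (Real.exp_nonneg _), ← Real.exp_add]
  simp

lemma integral_sq_gaussianReal (v : ℝ≥0) : ∫ z, z ^ 2 ∂(gaussianReal 0 v) = v := by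
  have h := variance_fun_id_gaussianReal (μ := 0) (v := v)
  rw [variance_eq_integral (by fun_prop)] at h
  simpa [integral_id_gaussianReal] using h

lemma integrable_sq_gaussianReal (v : ℝ≥0) : Integrable (fun z => z ^ 2) (gaussianReal 0 v) :=
  (memLp_id_gaussianReal 2).integrable_sq

lemma integrable_gaussianReal_id (v : ℝ≥0) : Integrable (fun z => z) (gaussianReal 0 v) :=
  (memLp_id_gaussianReal 1).integrable le_rfl

instance isProbabilityMeasure_inputOutputLaw (s : ℝ) (κ : Measure ℝ) [IsProbabilityMeasure κ] :
    IsProbabilityMeasure (inputOutputLaw s κ) :=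
  Measure.isProbabilityMeasure_map (by fun_prop)

lemma fst_inputOutputLaw (s : ℝ) (κ : Measure ℝ) [IsProbabilityMeasure κ] :
    (inputOutputLaw s κ).fst = κ := by
  rw [Measure.fst, inputOutputLaw, Measure.map_map measurable_fst (by fun_prop)]
  exact Measure.fst_prod

lemma inputOutputLaw_eq_withDensity (s : ℝ) (κ : Measure ℝ) [IsProbabilityMeasure κ] {v : ℝ≥0}
    (hv : v ≠ 0) :
    inputOutputLaw s κ = (κ.prod (gaussianReal 0 v)).withDensity
      fun p => ENNReal.ofReal (Real.exp (gaussianLLR v (s * p.1) p.2)) := by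
  have hm : Measurable fun p : ℝ × ℝ =>
      ENNReal.ofReal (Real.exp (gaussianLLR v (s * p.1) p.2)) := by
    unfold gaussianLLR; fun_prop
  refine Measure.ext_of_lintegral _ fun H hH => ?_
  rw [lintegral_withDensity_eq_lintegral_mul _ hm hH, inputOutputLaw,
    lintegral_map hH (by fun_prop), lintegral_prod _ (by fun_prop),
    lintegral_prod _ (hm.mul hH).aemeasurable]
  refine lintegral_congr fun u => ?_
  exact lintegral_gaussianReal_add hv (s * u) (H := fun y => H (u, y)) (by fun_prop)

lemma llr_inputOutputLaw (s : ℝ) (κ : Measure ℝ) [IsProbabilityMeasure κ] {v : ℝ≥0}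
    (hv : v ≠ 0) :
    inputOutputLaw s κ ≪ κ.prod (gaussianReal 0 v) ∧
    llr (inputOutputLaw s κ) (κ.prod (gaussianReal 0 v)) =ᵐ[inputOutputLaw s κ]
      fun p => gaussianLLR v (s * p.1) p.2 := by
  have hm : Measurable fun p : ℝ × ℝ =>
      ENNReal.ofReal (Real.exp (gaussianLLR v (s * p.1) p.2)) := by
    unfold gaussianLLR; fun_prop
  have hac : inputOutputLaw s κ ≪ κ.prod (gaussianReal 0 v) := by
    rw [inputOutputLaw_eq_withDensity s κ hv]
    exact withDensity_absolutelyContinuous _ _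
  refine ⟨hac, hac.ae_le ?_⟩
  have := Measure.rnDeriv_withDensity (κ.prod (gaussianReal 0 v)) hm
  rw [← inputOutputLaw_eq_withDensity s κ hv] at this
  filter_upwards [this] with p hp
  rw [llr, hp, ENNReal.toReal_ofReal (Real.exp_nonneg _), Real.log_exp]

/-- In terms of the independent pair (u, N) the log-likelihood ratio is a quadratic polynomial whose
cross term u N has mean zero. Only the second moment of `κ` survives, and it enters affinely. -/
lemma klDiv_inputOutputLaw (s : ℝ) (κ : Measure ℝ) [IsProbabilityMeasure κ]
    (hκ : MemLp id 2 κ) {v : ℝ≥0} (hv : v ≠ 0) :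
    klDiv (inputOutputLaw s κ) (κ.prod (gaussianReal 0 v)) =
      ENNReal.ofReal (1 / 2 * Real.log v + (s ^ 2 * ∫ u, u ^ 2 ∂κ + 1) / (2 * v) - 1 / 2) := by
  obtain ⟨hac, hllr⟩ := llr_inputOutputLaw s κ hv
  have hu2 : Integrable (fun u : ℝ => u ^ 2) κ := hκ.integrable_sq
  have hu1 : Integrable (fun u : ℝ => u) κ := hκ.integrable one_le_two
  set N := gaussianReal 0 1
  have i1 : Integrable (fun p : ℝ × ℝ => p.1 ^ 2) (κ.prod N) := hu2.comp_fst N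
  have i2 : Integrable (fun p : ℝ × ℝ => p.1 * p.2) (κ.prod N) :=
    hu1.mul_prod (integrable_gaussianReal_id 1)
  have i3 : Integrable (fun p : ℝ × ℝ => p.2 ^ 2) (κ.prod N) :=
    (integrable_sq_gaussianReal 1).comp_snd κ
  have e : ∀ p : ℝ × ℝ, gaussianLLR v (s * p.1) (s * p.1 + p.2) =
      1 / 2 * Real.log v + (s ^ 2 / (2 * v) * p.1 ^ 2 + s / v * (p.1 * p.2) +
        (1 / (2 * v) - 1 / 2) * p.2 ^ 2) := by
    intro p
    have : (v : ℝ) ≠ 0 := by exact_mod_cast hv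
    simp only [gaussianLLR]; field_simp; ring
  have hint : Integrable (fun p : ℝ × ℝ => gaussianLLR v (s * p.1) (s * p.1 + p.2)) (κ.prod N) := by
    simp only [e]
    exact (integrable_const _).add (((i1.const_mul _).add (i2.const_mul _)).add (i3.const_mul _))
  have hmap : AEMeasurable (fun p : ℝ × ℝ => (p.1, s * p.1 + p.2)) (κ.prod N) := by fun_prop
  have hsm : AEStronglyMeasurable (fun p : ℝ × ℝ => gaussianLLR v (s * p.1) p.2)
      ((κ.prod N).map fun p => (p.1, s * p.1 + p.2)) := by
    unfold gaussianLLR; fun_prop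
  have hint' : Integrable (fun p : ℝ × ℝ => gaussianLLR v (s * p.1) p.2) (inputOutputLaw s κ) := by
    rw [inputOutputLaw, integrable_map_measure hsm hmap]
    exact hint
  rw [klDiv_of_ac_of_integrable hac (hint'.congr hllr.symm), integral_congr_ae hllr,
    inputOutputLaw, integral_map hmap hsm]
  simp only [e]
  have j1 : Integrable (fun p : ℝ × ℝ => s ^ 2 / (2 * v) * p.1 ^ 2) (κ.prod N) := i1.const_mul _
  have j2 : Integrable (fun p : ℝ × ℝ => s / v * (p.1 * p.2)) (κ.prod N) := i2.const_mul _
  have j3 : Integrable (fun p : ℝ × ℝ => (1 / (2 * v) - 1 / 2) * p.2 ^ 2) (κ.prod N) :=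
    i3.const_mul _
  have j12 : Integrable (fun p : ℝ × ℝ =>
      s ^ 2 / (2 * v) * p.1 ^ 2 + s / v * (p.1 * p.2)) (κ.prod N) := j1.add j2
  have j123 : Integrable (fun p : ℝ × ℝ => s ^ 2 / (2 * v) * p.1 ^ 2 + s / v * (p.1 * p.2) +
      (1 / (2 * v) - 1 / 2) * p.2 ^ 2) (κ.prod N) := j12.add j3
  rw [integral_add (integrable_const _) j123, integral_add j12 j3, integral_add j1 j2]
  simp only [integral_const_mul]
  rw [integral_prod_mul (fun u : ℝ => u) (fun z : ℝ => z), integral_id_gaussianReal,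
    integral_fun_fst (fun u : ℝ => u ^ 2), integral_fun_snd (fun z : ℝ => z ^ 2),
    integral_sq_gaussianReal]
  congr 1
  have := isProbabilityMeasure_inputOutputLaw s κ
  rw [inputOutputLaw] at this
  simp
  ring

/-- Among all product measures with the given first marginal, the product of the marginals is the
closest one. -/
lemma klDiv_prod_marginals_le {α β : Type*} [MeasurableSpace α] [MeasurableSpace β]
    [StandardBorelSpace α] [Nonempty α] (ρ : Measure (α × β)) [IsProbabilityMeasure ρ]
    (Q : Measure β) [IsProbabilityMeasure Q] :
    klDiv ρ (ρ.fst.prod ρ.snd) ≤ klDiv ρ (ρ.fst.prod Q) := by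
  set ρ' := ρ.map Prod.swap
  have : IsProbabilityMeasure ρ' := Measure.isProbabilityMeasure_map (by fun_prop)
  have h1 : ρ' = ρ.snd ⊗ₘ ρ'.condKernel := by
    have := ρ'.disintegrate ρ'.condKernel
    rwa [show ρ'.fst = ρ.snd from Measure.fst_map_swap, eq_comm] at this
  have hback : ρ = ρ'.map Prod.swap := by
    rw [Measure.map_map measurable_swap measurable_swap]; simp
  have e : ∀ q : Measure β, [SFinite q] → ρ.fst.prod q = (q.prod ρ.fst).map Prod.swap :=
    fun q _ => Measure.prod_swap.symm
  -- Disintegrated over the second coordinate, the divergence from a product with `Q` splits into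
  -- that of the second marginal from `Q` plus the mutual information; the first summand is dropped
  -- below.
  have chain := klDiv_compProd_eq_add ρ.snd Q ρ'.condKernel (Kernel.const β ρ.fst)
  rw [Measure.compProd_const, Measure.compProd_const, ← h1] at chain
  calc klDiv ρ (ρ.fst.prod ρ.snd)
      = klDiv (ρ'.map Prod.swap) ((ρ.snd.prod ρ.fst).map Prod.swap) := by
        rw [← hback, ← e ρ.snd]
    _ ≤ klDiv ρ' (ρ.snd.prod ρ.fst) := klDiv_map_le _ _ measurable_swap
    _ ≤ klDiv ρ' (Q.prod ρ.fst) := by rw [chain]; exact le_add_self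
    _ = klDiv (ρ.map Prod.swap) ((ρ.fst.prod Q).map Prod.swap) := by rw [Measure.prod_swap]
    _ ≤ _ := klDiv_map_le _ _ measurable_swap

/-- Leaving `v` free is the point: fixing it at the output variance of the optimal allocation,
rather than of the actual input, keeps the bound affine in the input power. -/
lemma mutualInformation_inputOutputLaw_le (s : ℝ) (κ : Measure ℝ) [IsProbabilityMeasure κ]
    (hκ : MemLp id 2 κ) {v : ℝ≥0} (hv : v ≠ 0) :
    mutualInformation (inputOutputLaw s κ) ≤
      ENNReal.ofReal (1 / 2 * Real.log v + (s ^ 2 * ∫ u, u ^ 2 ∂κ + 1) / (2 * v) - 1 / 2) := by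
  rw [← klDiv_inputOutputLaw s κ hκ hv, mutualInformation, fst_inputOutputLaw]
  have := klDiv_prod_marginals_le (inputOutputLaw s κ) (gaussianReal 0 v)
  rwa [fst_inputOutputLaw] at this

/-- The mutual information of a Gaussian channel with Gaussian input. -/
lemma mutualInformation_gaussianReal (s : ℝ) (γ : ℝ≥0) :
    mutualInformation (inputOutputLaw s (gaussianReal 0 γ)) =
      ENNReal.ofReal (1 / 2 * Real.log (1 + s ^ 2 * γ)) := by
  -- For a Gaussian input the output marginal is itself centred Gaussian, so the divergence formula
  -- applies exactly with its variance.
  have hsnd : (inputOutputLaw s (gaussianReal 0 γ)).snd =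
      gaussianReal 0 (NNReal.mk (s ^ 2) (sq_nonneg s) * γ + 1) := by
    have h := gaussianReal_conv_gaussianReal (m₁ := 0) (m₂ := 0)
      (v₁ := NNReal.mk (s ^ 2) (sq_nonneg s) * γ) (v₂ := 1)
    have h2 := gaussianReal_map_const_mul (μ := 0) (v := γ) s
    rw [mul_zero] at h2
    rw [add_zero, ← h2, Measure.conv] at h
    rw [← h, Measure.snd, inputOutputLaw, Measure.map_map measurable_snd (by fun_prop)]
    nth_rw 2 [← Measure.map_id (μ := gaussianReal 0 1)]
    rw [Measure.map_prod_map _ _ (by fun_prop) (by fun_prop),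
      Measure.map_map (by fun_prop) (by fun_prop)]
    rfl
  have hv : (NNReal.mk (s ^ 2) (sq_nonneg s) * γ + 1 : ℝ≥0) ≠ 0 := by positivity
  rw [mutualInformation, fst_inputOutputLaw, hsnd,
    klDiv_inputOutputLaw s _ (memLp_id_gaussianReal 2) hv, integral_sq_gaussianReal]
  congr 1
  have h3 : ((NNReal.mk (s ^ 2) (sq_nonneg s) * γ + 1 : ℝ≥0) : ℝ) = s ^ 2 * γ + 1 := rfl
  have h4 : s ^ 2 * (γ : ℝ) + 1 ≠ 0 := by positivity
  rw [h3, add_comm 1]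
  field_simp
  ring

/-! ### The information capacity -/

namespace GaussianFSMC

variable {m : ℕ} (F : GaussianFSMC m)

lemma sum_ofReal_pairProb (csi : CSI) (f : Fin m → Fin m → ℝ) (hf : ∀ i j, 0 ≤ f i j) :
    ∑ i, ∑ j, ENNReal.ofReal (F.pairProb csi i j) * ENNReal.ofReal (f i j) =
      ENNReal.ofReal (∑ i, ∑ j, F.pairProb csi i j * f i j) := by
  have h0 : ∀ i j, 0 ≤ F.pairProb csi i j * f i j := fun i j =>
    mul_nonneg (F.pairProb_nonneg csi i j) (hf i j)
  rw [ENNReal.ofReal_sum_of_nonneg fun i _ => Finset.sum_nonneg fun j _ => h0 i j]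
  refine Finset.sum_congr rfl fun i _ => ?_
  rw [ENNReal.ofReal_sum_of_nonneg fun j _ => h0 i j]
  exact Finset.sum_congr rfl fun j _ => (ENNReal.ofReal_mul (F.pairProb_nonneg csi i j)).symm

lemma allocationRate_mem_informationRates (csi : CSI) {P : ℝ} {γ : Fin m → ℝ}
    (hγ : γ ∈ F.powerAllocations P) :
    ENNReal.ofReal (F.allocationRate csi γ) ∈ F.informationRates csi P := by
  refine ⟨fun i => ⟨gaussianReal 0 (γ i).toNNReal, inferInstance⟩, ?_, ?_⟩
  · have : ∀ i, ∫⁻ u, ENNReal.ofReal (u ^ 2) ∂(gaussianReal 0 (γ i).toNNReal) =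
        ENNReal.ofReal (γ i) := by
      intro i
      rw [← ofReal_integral_eq_lintegral_ofReal (integrable_sq_gaussianReal _)
        (ae_of_all _ fun u => sq_nonneg u), integral_sq_gaussianReal, Real.coe_toNNReal _ (hγ.1 i)]
    simp only [ProbabilityMeasure.coe_mk, this, ← ENNReal.ofReal_mul (F.stat_nonneg _)]
    rw [← ENNReal.ofReal_sum_of_nonneg fun i _ => mul_nonneg (F.stat_nonneg i) (hγ.1 i)]
    exact ENNReal.ofReal_le_ofReal hγ.2
  · simp only [ProbabilityMeasure.coe_mk, mutualInformation_gaussianReal,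
      Real.coe_toNNReal _ (hγ.1 _)]
    rw [F.sum_ofReal_pairProb csi fun i j => 1 / 2 * Real.log (1 + F.gain j ^ 2 * γ i)]
    · congr 1
      simp only [allocationRate, Finset.mul_sum]
      exact Finset.sum_congr rfl fun i _ => Finset.sum_congr rfl fun j _ => by ring
    · intro i j
      have := mul_nonneg (sq_nonneg (F.gain j)) (hγ.1 i)
      exact mul_nonneg (by norm_num) (Real.log_nonneg (by linarith))

/-- With the reference variance 1 + S²Γ, the bound on each divergence is the rate under Γ plus half
of S² (U − Γ) / (1 + S²Γ). The mean of the second part is nonpositive by the variational inequality,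
because the conditional powers `U` form a feasible allocation. -/
lemma informationRate_le {csi : CSI} {P : ℝ} (hP : 0 ≤ P) {Γ : Fin m → ℝ}
    (hΓ : F.IsOptimalAllocation csi P Γ) {I : ℝ≥0∞} (hI : I ∈ F.informationRates csi P) :
    I ≤ ENNReal.ofReal (F.allocationRate csi Γ) := by
  obtain ⟨κ, hκ, rfl⟩ := hI
  -- A finite mean power bounds each conditional power because every state is charged.
  have hfin : ∀ i, ∫⁻ u, ENNReal.ofReal (u ^ 2) ∂(κ i : Measure ℝ) ≠ ∞ := by
    intro i h
    have h1 := (Finset.single_le_sum (f := fun i => ENNReal.ofReal (F.stat i) *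
      ∫⁻ u, ENNReal.ofReal (u ^ 2) ∂(κ i : Measure ℝ)) (fun _ _ => zero_le)
      (Finset.mem_univ i)).trans hκ
    simp only [h] at h1
    rw [ENNReal.mul_top (by simpa using F.stat_pos i), top_le_iff] at h1
    exact ENNReal.ofReal_ne_top h1
  have hmem : ∀ i, MemLp id 2 (κ i : Measure ℝ) := fun i => by
    rw [memLp_two_iff_integrable_sq (by fun_prop)]
    refine ⟨by fun_prop, ?_⟩
    rw [hasFiniteIntegral_iff_ofReal (ae_of_all _ fun u => sq_nonneg _)]
    exact (hfin i).lt_top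
  set U : Fin m → ℝ := fun i => ∫ u, u ^ 2 ∂(κ i : Measure ℝ)
  have hU0 : ∀ i, 0 ≤ U i := fun i => integral_nonneg fun u => sq_nonneg u
  have hU : U ∈ F.powerAllocations P := by
    refine ⟨hU0, ?_⟩
    rw [← ENNReal.ofReal_le_ofReal_iff hP, ENNReal.ofReal_sum_of_nonneg fun i _ =>
      mul_nonneg (F.stat_nonneg i) (hU0 i)]
    refine le_of_eq_of_le (Finset.sum_congr rfl fun i _ => ?_) hκ
    have h := ofReal_integral_eq_lintegral_ofReal (hmem i).integrable_sq
      (ae_of_all _ fun u => sq_nonneg u)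
    simp only [id] at h
    rw [ENNReal.ofReal_mul (F.stat_nonneg i), ← h]
  have hpos : ∀ i j, 0 < 1 + F.gain j ^ 2 * Γ i := fun i j => by
    have := mul_nonneg (sq_nonneg (F.gain j)) (hΓ.1.1 i); linarith
  set R : Fin m → Fin m → ℝ := fun i j => 1 / 2 * Real.log (1 + F.gain j ^ 2 * Γ i) +
    (F.gain j ^ 2 * U i + 1) / (2 * (1 + F.gain j ^ 2 * Γ i)) - 1 / 2
  have hbound : ∀ i j, mutualInformation (inputOutputLaw (F.gain j) (κ i)) ≤
      ENNReal.ofReal (max (R i j) 0) := by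
    intro i j
    have hv : (1 + F.gain j ^ 2 * Γ i).toNNReal ≠ 0 := by simpa using hpos i j
    have := mutualInformation_inputOutputLaw_le (F.gain j) (κ i) (hmem i) hv
    rw [Real.coe_toNNReal _ (hpos i j).le] at this
    exact this.trans (ENNReal.ofReal_le_ofReal (le_max_left _ _))
  -- From log v ≥ 1 − 1/v. Nonnegativity is needed to carry the weighted sum inside
  -- `ENNReal.ofReal`.
  have hRpos : ∀ i j, 0 ≤ R i j := by
    intro i j
    have h1 := Real.one_sub_inv_le_log_of_pos (hpos i j)
    have h2 : (F.gain j ^ 2 * U i + 1) / (2 * (1 + F.gain j ^ 2 * Γ i)) ≥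
        1 / 2 * (1 + F.gain j ^ 2 * Γ i)⁻¹ := by
      rw [div_eq_mul_inv, mul_inv]
      have h3 := mul_nonneg (sq_nonneg (F.gain j)) (hU0 i)
      have h4 := inv_pos.2 (hpos i j)
      nlinarith [mul_nonneg h3 h4.le]
    simp only [R]
    linarith
  simp only [max_eq_left (hRpos _ _)] at hbound
  calc _ ≤ ∑ i, ∑ j, ENNReal.ofReal (F.pairProb csi i j) * ENNReal.ofReal (R i j) := by
        gcongr with i _ j _
        exact hbound i j
    _ = ENNReal.ofReal (∑ i, ∑ j, F.pairProb csi i j * R i j) := F.sum_ofReal_pairProb csi R hRpos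
    _ ≤ _ := by
        refine ENNReal.ofReal_le_ofReal ?_
        have hvi := hΓ.sum_marginalGain_le F hU
        have e : ∀ i, ∑ j, F.pairProb csi i j * R i j =
            1 / 2 * ∑ j, F.pairProb csi i j * Real.log (1 + F.gain j ^ 2 * Γ i) +
            1 / 2 * (F.stat i * F.marginalGain csi Γ i * U i -
              F.stat i * F.marginalGain csi Γ i * Γ i) := by
          intro i
          rw [← mul_sub, stat_mul_marginalGain, Finset.sum_mul, ← mul_add,
            ← Finset.sum_add_distrib, Finset.mul_sum]
          refine Finset.sum_congr rfl fun j _ => ?_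
          have := (hpos i j).ne'
          simp only [R]
          field_simp
          ring
        simp only [e, Finset.sum_add_distrib, ← Finset.mul_sum, Finset.sum_sub_distrib]
        rw [allocationRate]
        linarith

lemma isGreatest_informationRates {csi : CSI} {P : ℝ} (hP : 0 ≤ P) {Γ : Fin m → ℝ}
    (hΓ : F.IsOptimalAllocation csi P Γ) :
    IsGreatest (F.informationRates csi P) (ENNReal.ofReal (F.allocationRate csi Γ)) :=
  ⟨F.allocationRate_mem_informationRates csi hΓ.1, fun _ hI => F.informationRate_le hP hΓ hI⟩

end GaussianFSMC

/-! ### Additive Gaussian noise with feedback: change of measure and orthogonality -/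

lemma lintegral_pi_snoc (n : ℕ) (μ : Fin (n + 1) → Measure ℝ) [∀ i, SigmaFinite (μ i)]
    {H : (Fin (n + 1) → ℝ) → ℝ≥0∞} (hH : Measurable H) :
    ∫⁻ z, H z ∂(Measure.pi μ) =
      ∫⁻ z, ∫⁻ t, H (Fin.snoc z t) ∂(μ (Fin.last n)) ∂(Measure.pi fun i => μ i.castSucc) := by
  have h := (measurePreserving_piFinSuccAbove μ (Fin.last n)).symm
  have e : ∀ p : ℝ × (Fin n → ℝ),
      (MeasurableEquiv.piFinSuccAbove (fun _ => ℝ) (Fin.last n)).symm p = Fin.snoc p.2 p.1 :=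
    fun p => Fin.insertNth_last' p.1 p.2
  have hm : Measurable fun p : ℝ × (Fin n → ℝ) => (Fin.snoc p.2 p.1 : Fin (n + 1) → ℝ) := by
    simp only [← e]
    exact MeasurableEquiv.measurable _
  rw [← h.lintegral_comp hH]
  simp only [e, Fin.succAbove_last]
  exact lintegral_prod_symm' (fun p : ℝ × (Fin n → ℝ) => H (Fin.snoc p.2 p.1)) (hH.comp hm)

lemma measurable_fin_snoc (n : ℕ) :
    Measurable fun p : (Fin n → ℝ) × ℝ => (Fin.snoc p.1 p.2 : Fin (n + 1) → ℝ) := by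
  refine measurable_pi_iff.2 fun i => ?_
  rcases i.eq_castSucc_or_eq_last with ⟨i, rfl⟩ | rfl
  · simp only [Fin.snoc_castSucc (α := fun _ => ℝ)]; fun_prop
  · simp only [Fin.snoc_last]; fun_prop

/-- The outputs `y_k = g_k(y_0, …, y_{k - 1}) + z_k` of an additive noise channel with feedback. -/
def feedbackMap (g : (k : ℕ) → (Fin k → ℝ) → ℝ) : (n : ℕ) → (Fin n → ℝ) → Fin n → ℝ
  | 0, z => z
  | n + 1, z => Fin.snoc (feedbackMap g n (Fin.init z))
      (g n (feedbackMap g n (Fin.init z)) + z (Fin.last n))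

lemma feedbackMap_snoc (g : (k : ℕ) → (Fin k → ℝ) → ℝ) (n : ℕ) (z : Fin n → ℝ) (t : ℝ) :
    feedbackMap g (n + 1) (Fin.snoc z t) =
      Fin.snoc (feedbackMap g n z) (g n (feedbackMap g n z) + t) := by
  simp only [feedbackMap, Fin.init_snoc, Fin.snoc_last]

/-- `feedbackMap` is built by appending the newest output, which suits induction on the horizon;
this is the channel equation it solves, used to match it with `output`. -/
lemma feedbackMap_apply (g : (k : ℕ) → (Fin k → ℝ) → ℝ) (n : ℕ) (z : Fin n → ℝ) (k : Fin n) :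
    feedbackMap g n z k =
      g k (fun i => feedbackMap g n z ⟨i, i.2.trans k.2⟩) + z k := by
  induction n with
  | zero => exact k.elim0
  | succ n ih =>
    have hpre : ∀ i : Fin n, feedbackMap g (n + 1) z i.castSucc = feedbackMap g n (Fin.init z) i :=
      fun i => Fin.snoc_castSucc (α := fun _ => ℝ) _ _ i
    rcases k.eq_castSucc_or_eq_last with ⟨k, rfl⟩ | rfl
    · rw [hpre, ih]
      congr 2
      funext i
      exact (hpre ⟨i, i.2.trans k.2⟩).symm
    · have : (fun i : Fin n => feedbackMap g (n + 1) z ⟨i, i.2.trans n.lt_succ_self⟩) =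
          feedbackMap g n (Fin.init z) := funext hpre
      simp only [Fin.val_last]
      rw [this]
      exact Fin.snoc_last (α := fun _ => ℝ) _ _

lemma measurable_feedbackMap {g : (k : ℕ) → (Fin k → ℝ) → ℝ} (hg : ∀ k, Measurable (g k)) (n : ℕ) :
    Measurable (feedbackMap g n) := by
  induction n with
  | zero => exact measurable_id
  | succ n ih =>
    have hi : Measurable fun z : Fin (n + 1) → ℝ => (Fin.init z : Fin n → ℝ) :=
      measurable_pi_iff.2 fun i => measurable_pi_apply _
    have h1 := ih.comp hi
    exact (measurable_fin_snoc n).comp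
      (h1.prodMk (((hg n).comp h1).add (measurable_pi_apply _)))

/-- Under the exponential of minus the log-likelihood ratio, the outputs of a Gaussian channel with
feedback become independent centred Gaussian variables. -/
lemma lintegral_exp_neg_sum_gaussianLLR {g : (k : ℕ) → (Fin k → ℝ) → ℝ}
    (hg : ∀ k, Measurable (g k)) {v : ℕ → ℝ≥0} (hv : ∀ k, v k ≠ 0) (n : ℕ)
    {H : (Fin n → ℝ) → ℝ≥0∞} (hH : Measurable H) :
    ∫⁻ z, ENNReal.ofReal (Real.exp (-∑ k : Fin n, gaussianLLR (v k)
        (g k fun i => feedbackMap g n z ⟨i, i.2.trans k.2⟩) (feedbackMap g n z k))) *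
        H (feedbackMap g n z) ∂(Measure.pi fun _ => gaussianReal 0 1) =
      ∫⁻ y, H y ∂(Measure.pi fun k : Fin n => gaussianReal 0 (v k)) := by
  induction n with
  | zero => 
    simp only [Finset.univ_eq_empty, Finset.sum_empty, neg_zero, Real.exp_zero, ENNReal.ofReal_one,
      one_mul, feedbackMap]
    congr 2
    funext k
    exact k.elim0
  | succ n ih =>
    have hY : ∀ n, Measurable (feedbackMap g n) := measurable_feedbackMap hg
    have hsum : ∀ n, Measurable fun z => ∑ k : Fin n, gaussianLLR (v k)
        (g k fun i => feedbackMap g n z ⟨i, i.2.trans k.2⟩) (feedbackMap g n z k) := by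
      intro n
      refine Finset.measurable_sum _ fun k _ => ?_
      refine (measurable_gaussianLLR (v k)).comp (Measurable.prodMk ((hg k).comp ?_) ?_)
      · exact measurable_pi_iff.2 fun i => (measurable_pi_apply _).comp (hY n)
      · exact (measurable_pi_apply _).comp (hY n)
    have hL : Measurable fun z => ENNReal.ofReal (Real.exp (-∑ k : Fin (n + 1), gaussianLLR (v k)
        (g k fun i => feedbackMap g (n + 1) z ⟨i, i.2.trans k.2⟩)
          (feedbackMap g (n + 1) z k))) * H (feedbackMap g (n + 1) z) :=
      ((hsum _).neg.exp.ennreal_ofReal).mul (hH.comp (hY _))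
    -- The last noise is integrated first: with the earlier noise fixed, the last shift `g n` is a
    -- constant and the one-step change of measure applies.
    rw [lintegral_pi_snoc _ _ hL, lintegral_pi_snoc _ _ hH]
    have hH' : Measurable fun y : Fin n → ℝ =>
        ∫⁻ t, H (Fin.snoc y t) ∂(gaussianReal 0 (v n)) :=
      (hH.comp (measurable_fin_snoc n)).lintegral_prod_right'
    refine Eq.trans (lintegral_congr fun z => ?_) (ih hH')
    have hsplit : ∀ t : ℝ, (∑ k : Fin (n + 1), gaussianLLR (v k)
        (g k fun i => feedbackMap g (n + 1) (Fin.snoc z t) ⟨i, i.2.trans k.2⟩)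
          (feedbackMap g (n + 1) (Fin.snoc z t) k)) =
        (∑ k : Fin n, gaussianLLR (v k)
          (g k fun i => feedbackMap g n z ⟨i, i.2.trans k.2⟩) (feedbackMap g n z k)) +
        gaussianLLR (v n) (g n (feedbackMap g n z)) (g n (feedbackMap g n z) + t) := by
      intro t
      have hpre : ∀ i : Fin n,
          feedbackMap g (n + 1) (Fin.snoc z t) i.castSucc = feedbackMap g n z i := by
        intro i
        rw [feedbackMap_snoc]
        exact Fin.snoc_castSucc (α := fun _ => ℝ) _ _ i
      rw [Fin.sum_univ_castSucc]
      congr 1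
      · refine Finset.sum_congr rfl fun k _ => ?_
        rw [hpre]
        congr 2
        funext i
        exact hpre ⟨i, i.2.trans k.2⟩
      · have : (fun i : Fin n => feedbackMap g (n + 1) (Fin.snoc z t)
            ⟨i, i.2.trans n.lt_succ_self⟩) = feedbackMap g n z := funext hpre
        simp only [Fin.val_last]
        rw [this, feedbackMap_snoc]
        congr 1
        exact Fin.snoc_last (α := fun _ => ℝ) _ _
    simp only [hsplit]
    simp only [feedbackMap_snoc, neg_add, Real.exp_add,
      ENNReal.ofReal_mul (Real.exp_nonneg _), mul_assoc]
    have hm : Measurable fun y => H (Fin.snoc (feedbackMap g n z) y) :=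
      hH.comp ((measurable_fin_snoc n).comp measurable_prodMk_left)
    rw [lintegral_const_mul]
    · congr 1
      exact lintegral_exp_neg_gaussianLLR (hv n) (g n (feedbackMap g n z)) hm
    · have h2 : Measurable fun t : ℝ => g n (feedbackMap g n z) + t := measurable_const_add _
      refine Measurable.mul ?_ (hm.comp h2)
      exact ((measurable_gaussianLLR (v n)).comp
        (measurable_const.prodMk h2)).neg.exp.ennreal_ofReal

/-- The law of `n` independent standard Gaussian variables. -/
noncomputable abbrev noiseLaw (n : ℕ) : Measure (Fin n → ℝ) := Measure.pi fun _ => gaussianReal 0 1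

lemma measurePreserving_noise_eval {n : ℕ} (k : Fin n) :
    MeasurePreserving (fun z : Fin n → ℝ => z k) (noiseLaw n) (gaussianReal 0 1) :=
  measurePreserving_eval _ k

lemma memLp_noise {n : ℕ} (k : Fin n) : MemLp (fun z : Fin n → ℝ => z k) 2 (noiseLaw n) :=
  (memLp_id_gaussianReal 2).comp_measurePreserving (measurePreserving_noise_eval k)

lemma integral_noise_sq {n : ℕ} (k : Fin n) : ∫ z, z k ^ 2 ∂(noiseLaw n) = 1 := by
  have h := integral_map (μ := noiseLaw n) (φ := fun z : Fin n → ℝ => z k)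
    (f := fun t : ℝ => t ^ 2) (measurable_pi_apply k).aemeasurable (by fun_prop)
  rw [(measurePreserving_noise_eval k).map_eq, integral_sq_gaussianReal] at h
  exact_mod_cast h.symm

/-- A functional of the noise before time `k` is uncorrelated with the noise at time `k`. -/
lemma integral_mul_noise {n : ℕ} (k : Fin n) {f : (Fin n → ℝ) → ℝ} (hf : Measurable f)
    (hdep : ∀ z z' : Fin n → ℝ, (∀ i < k, z i = z' i) → f z = f z') :
    ∫ z, f z * z k ∂(noiseLaw n) = 0 := by
  classical
  have hind : iIndepFun (fun (i : Fin n) (z : Fin n → ℝ) => z i) (noiseLaw n) :=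
    iIndepFun_pi (μ := fun _ : Fin n => gaussianReal 0 1) (X := fun _ => id) fun _ => aemeasurable_id
  have h1 := hind.indepFun_finset (Finset.univ.filter (· < k)) {k} (by simp) fun i =>
    measurable_pi_apply i
  -- Filling the coordinates from `k` on with zeros exhibits `f` as a function of the earlier noise
  -- alone, hence independent of the noise at time `k`.
  have hext : Measurable fun (y : (Finset.univ.filter (· < k) : Finset (Fin n)) → ℝ) =>
      f fun i => if h : i ∈ Finset.univ.filter (· < k) then y ⟨i, h⟩ else 0 := by
    refine hf.comp (measurable_pi_iff.2 fun i => ?_)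
    split_ifs
    · exact measurable_pi_apply _
    · exact measurable_const
  have h2 := h1.comp hext (measurable_pi_apply (⟨k, by simp⟩ : ({k} : Finset (Fin n))))
  have h3 : IndepFun f (fun z : Fin n → ℝ => z k) (noiseLaw n) := by
    refine h2.congr (ae_of_all _ fun z => Eq.symm ?_) (ae_of_all _ fun z => rfl)
    refine hdep _ _ fun i hi => ?_
    simp [hi]
  have h4 : ∫ z, z k ∂(noiseLaw n) = 0 := by
    have h := integral_map (μ := noiseLaw n) (φ := fun z : Fin n → ℝ => z k)
      (f := fun t : ℝ => t) (measurable_pi_apply k).aemeasurable (by fun_prop)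
    rw [(measurePreserving_noise_eval k).map_eq, integral_id_gaussianReal] at h
    exact h.symm
  have := h3.integral_mul_eq_mul_integral hf.aestronglyMeasurable
    (measurable_pi_apply k).aestronglyMeasurable
  simp only [Pi.mul_apply] at this
  rw [this, h4, mul_zero]

/-- The cross term vanishes by `integral_mul_noise`. This is all the probability needed both for
output powers in the converse and for the error recursion of the code. -/
lemma integral_sq_add_noise {n : ℕ} (k : Fin n) {f : (Fin n → ℝ) → ℝ} (hf : Measurable f)
    (hdep : ∀ z z' : Fin n → ℝ, (∀ i < k, z i = z' i) → f z = f z') (hL : MemLp f 2 (noiseLaw n))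
    (a b : ℝ) :
    ∫ z, (a * f z + b * z k) ^ 2 ∂(noiseLaw n) = a ^ 2 * ∫ z, f z ^ 2 ∂(noiseLaw n) + b ^ 2 := by
  have e : ∀ z : Fin n → ℝ, (a * f z + b * z k) ^ 2 =
      a ^ 2 * f z ^ 2 + 2 * a * b * (f z * z k) + b ^ 2 * z k ^ 2 := fun z => by ring
  have i1 : Integrable (fun z => a ^ 2 * f z ^ 2) (noiseLaw n) := hL.integrable_sq.const_mul _
  have i2 : Integrable (fun z => 2 * a * b * (f z * z k)) (noiseLaw n) :=
    (hL.integrable_mul (memLp_noise k)).const_mul _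
  have i3 : Integrable (fun z : Fin n → ℝ => b ^ 2 * z k ^ 2) (noiseLaw n) :=
    (memLp_noise k).integrable_sq.const_mul _
  have i12 : Integrable (fun z => a ^ 2 * f z ^ 2 + 2 * a * b * (f z * z k)) (noiseLaw n) :=
    i1.add i2
  simp only [e]
  rw [integral_add i12 i3, integral_add i1 i2, integral_const_mul, integral_const_mul,
    integral_const_mul, integral_mul_noise k hf hdep, integral_noise_sq]
  ring

/-! ### The channel law, causality of inputs and outputs -/

namespace GaussianFSMC

variable {m : ℕ} (F : GaussianFSMC m) {csi : CSI} {M K : ℕ}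

instance isFiniteMeasure_stateLaw (K : ℕ) : IsFiniteMeasure (F.stateLaw K) := by
  refine ⟨?_⟩
  rw [stateLaw, Measure.coe_finsetSum, Finset.sum_apply]
  refine ENNReal.sum_lt_top.2 fun x _ => ?_
  simp [ENNReal.ofReal_lt_top]

lemma lintegral_stateLaw (K : ℕ) (H : (Fin (K + 1) → Fin m) → ℝ≥0∞) :
    ∫⁻ x, H x ∂(F.stateLaw K) = ∑ x, ENNReal.ofReal (F.pathProb K x) * H x := by
  rw [stateLaw, lintegral_finsetSum_measure]
  refine Finset.sum_congr rfl fun x _ => ?_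
  rw [lintegral_smul_measure, lintegral_dirac]
  rfl

lemma lintegral_uniformOn_univ (M : ℕ) (H : Fin M → ℝ≥0∞) :
    ∫⁻ w, H w ∂(uniformOn Set.univ) = (M : ℝ≥0∞)⁻¹ * ∑ w, H w := by
  rw [uniformOn, ProbabilityTheory.cond, Measure.restrict_univ, lintegral_smul_measure,
    lintegral_count, tsum_fintype, Measure.count_univ]
  simp

/-- Expectations over the message, the states and the noise. -/
lemma lintegral_law (M K : ℕ)
    {H : Fin M × (Fin (K + 1) → Fin m) × (Fin (K + 1) → ℝ) → ℝ≥0∞}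
    (hH : ∀ w x, Measurable fun z => H (w, x, z)) :
    ∫⁻ ω, H ω ∂(F.law M K) = ∑ x, ENNReal.ofReal (F.pathProb K x) *
      ((M : ℝ≥0∞)⁻¹ * ∑ w, ∫⁻ z, H (w, x, z) ∂(noiseLaw (K + 1))) := by
  have hm : Measurable H :=
    measurable_from_prod_countable_right fun w => measurable_from_prod_countable_right fun x =>
      hH w x
  rw [law, lintegral_prod _ hm.aemeasurable, lintegral_uniformOn_univ]
  have : ∀ w, ∫⁻ p, H (w, p) ∂((F.stateLaw K).prod (noiseLaw (K + 1))) =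
      ∑ x, ENNReal.ofReal (F.pathProb K x) * ∫⁻ z, H (w, x, z) ∂(noiseLaw (K + 1)) := by
    intro w
    have hw : Measurable fun p => H (w, p) := hm.comp measurable_prodMk_left
    rw [lintegral_prod _ hw.aemeasurable, lintegral_stateLaw]
  simp only [this]
  rw [Finset.sum_comm, Finset.mul_sum]
  refine Finset.sum_congr rfl fun x _ => ?_
  rw [← Finset.mul_sum]
  ring

lemma output_eq (c : FeedbackCode m csi M K) (w : Fin M) (x : Fin (K + 1) → Fin m)
    (z : Fin (K + 1) → ℝ) (k : ℕ) (hk : k < K + 1) :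
    F.output c w x z k hk = F.gain (x ⟨k, hk⟩) * F.input c w x z ⟨k, hk⟩ + z ⟨k, hk⟩ := by
  rw [output]; rfl

lemma measurable_output (c : FeedbackCode m csi M K) (w : Fin M) (x : Fin (K + 1) → Fin m)
    (k : ℕ) (hk : k < K + 1) : Measurable fun z => F.output c w x z k hk := by
  induction k using Nat.strong_induction_on with
  | _ k ih =>
    have h : (fun z => F.output c w x z k hk) = fun z =>
        F.gain (x ⟨k, hk⟩) * F.input c w x z ⟨k, hk⟩ + z ⟨k, hk⟩ :=
      funext fun z => F.output_eq c w x z k hk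
    rw [h]
    refine (Measurable.const_mul ?_ _).add (measurable_pi_apply _)
    exact (c.measurable_enc _ w _).comp (measurable_pi_iff.2 fun i => ih i i.2 _)

lemma measurable_input (c : FeedbackCode m csi M K) (w : Fin M) (x : Fin (K + 1) → Fin m)
    (k : Fin (K + 1)) : Measurable fun z => F.input c w x z k :=
  (c.measurable_enc _ w _).comp (measurable_pi_iff.2 fun _ => F.measurable_output c w x _ _)

/-- The output at time `k` depends on the states and the noise up to time `k` only. -/
lemma output_congr (c : FeedbackCode m csi M K) (w : Fin M) {x x' : Fin (K + 1) → Fin m}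
    {z z' : Fin (K + 1) → ℝ} (k : ℕ) (hk : k < K + 1)
    (hx : ∀ i : Fin (K + 1), (i : ℕ) ≤ k → x i = x' i)
    (hz : ∀ i : Fin (K + 1), (i : ℕ) ≤ k → z i = z' i) :
    F.output c w x z k hk = F.output c w x' z' k hk := by
  induction k using Nat.strong_induction_on with
  | _ k ih =>
    rw [output_eq, output_eq, hx ⟨k, hk⟩ le_rfl, hz ⟨k, hk⟩ le_rfl, input, input]
    congr 3
    · funext i
      exact ih i i.2 _ (fun j hj => hx j (hj.trans i.2.le)) (fun j hj => hz j (hj.trans i.2.le))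
    · funext i
      exact hx _ (by have : (i : ℕ) < k + 1 - csi.delay := i.2; simp only; omega)

/-- The input at time `k` depends on the states up to time `k - d` and on the noise before time `k`
only. -/
lemma input_congr (c : FeedbackCode m csi M K) (w : Fin M) {x x' : Fin (K + 1) → Fin m}
    {z z' : Fin (K + 1) → ℝ} (k : Fin (K + 1))
    (hx : ∀ i : Fin (K + 1), (i : ℕ) < k + 1 - csi.delay → x i = x' i)
    (hz : ∀ i : Fin (K + 1), i < k → z i = z' i) :
    F.input c w x z k = F.input c w x' z' k := by
  -- Outputs before time `k` involve states up to `k - 1`; for d ≤ 1 the transmitter knows these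
  -- anyway, so feedback reveals no further states.
  have hd : csi.delay ≤ 1 := by cases csi <;> simp [CSI.delay]
  rw [input, input]
  congr 1
  · funext i
    have := i.2
    exact F.output_congr c w i _ (fun j hj => hx j (by omega))
      (fun j hj => hz j (Fin.lt_def.2 (by omega)))
  · funext i
    exact hx _ i.2

/-- The change of measure that makes the outputs independent of the message. -/
lemma lintegral_exp_neg_sum_output (c : FeedbackCode m csi M K) (w : Fin M)
    (x : Fin (K + 1) → Fin m) {v : ℕ → ℝ≥0} (hv : ∀ k, v k ≠ 0)
    {H : (Fin (K + 1) → ℝ) → ℝ≥0∞} (hH : Measurable H) :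
    ∫⁻ z, ENNReal.ofReal (Real.exp (-∑ k : Fin (K + 1), gaussianLLR (v k)
        (F.gain (x k) * F.input c w x z k) (F.output c w x z k k.2))) *
        H (fun k => F.output c w x z k k.2) ∂(noiseLaw (K + 1)) =
      ∫⁻ y, H y ∂(Measure.pi fun k : Fin (K + 1) => gaussianReal 0 (v k)) := by
  -- With message and states fixed, the code is a feedback channel; the value 0 past the horizon
  -- only makes `g` total.
  let g : (k : ℕ) → (Fin k → ℝ) → ℝ := fun k y =>
    if h : k < K + 1 then F.gain (x ⟨k, h⟩) * c.enc ⟨k, h⟩ w y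
      (fun i => x ⟨i, lt_of_lt_of_le i.2 ((Nat.sub_le _ _).trans h)⟩) else 0
  have hg : ∀ k, Measurable (g k) := by
    intro k
    by_cases h : k < K + 1
    · simp only [g, h, dite_true]
      exact Measurable.const_mul (c.measurable_enc ⟨k, h⟩ w _) (F.gain _)
    · simp only [g, h, dite_false]
      exact measurable_const
  have hout : ∀ z k (hk : k < K + 1), F.output c w x z k hk = feedbackMap g (K + 1) z ⟨k, hk⟩ := by
    intro z k hk
    induction k using Nat.strong_induction_on with
    | _ k ih =>
      rw [feedbackMap_apply, output_eq, input]
      simp only [g, hk, dite_true]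
      congr 3
      funext i
      exact ih i i.2 _
  have hin : ∀ z (k : Fin (K + 1)), F.gain (x k) * F.input c w x z k =
      g k fun i => feedbackMap g (K + 1) z ⟨i, i.2.trans k.2⟩ := by
    intro z k
    simp only [g, k.2, dite_true, input, hout]
  simp only [hin, hout]
  exact lintegral_exp_neg_sum_gaussianLLR hg hv (K + 1) hH

end GaussianFSMC

/-! ### The converse -/

namespace GaussianFSMC

variable {m : ℕ} (F : GaussianFSMC m) {csi : CSI} {M K : ℕ}

/-- The time `k - d` of the state that is known to the transmitter at time `k`. -/
def delayedTime (csi : CSI) (k : Fin (K + 1)) : Fin (K + 1) :=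
  ⟨k - csi.delay, (Nat.sub_le _ _).trans_lt k.2⟩

/-- Input powers at time `k` depend only on states up to `k - d`; given these, the current state has
the d-step transition law. The condition on `k` excludes `k = 0` with d = 1, where truncated
subtraction would make `delayedTime` the current time. -/
lemma sum_pathProb_markov_delay (k : Fin (K + 1)) (hk : csi.delay ≤ k)
    {G : (Fin (K + 1) → Fin m) → ℝ}
    (hG : ∀ x x' : Fin (K + 1) → Fin m,
      (∀ i : Fin (K + 1), (i : ℕ) < k + 1 - csi.delay → x i = x' i) → G x = G x')
    (A : Fin m → Fin m → ℝ) :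
    ∑ x, F.pathProb K x * (G x * A (x (delayedTime csi k)) (x k)) =
      ∑ x, F.pathProb K x * (G x *
        ∑ j, (F.trans ^ csi.delay) (x (delayedTime csi k)) j * A (x (delayedTime csi k)) j) := by
  cases csi with
  | instantaneous =>
    refine Finset.sum_congr rfl fun x _ => ?_
    have : delayedTime .instantaneous k = k := rfl
    simp only [this, CSI.delay, pow_zero]
    rw [Finset.sum_eq_single (x k) (fun j _ hj => by simp [Matrix.one_apply_ne' hj]) (by simp)]
    simp
  | delayed =>
    obtain ⟨k, hk'⟩ := k
    simp only [CSI.delay] at hk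
    obtain ⟨k, rfl⟩ : ∃ l, k = l + 1 := ⟨k - 1, by omega⟩
    have := F.sum_pathProb_markov K k (by omega) G (fun x x' h => hG x x' fun i hi => h i (by
      simp only [CSI.delay] at hi; omega)) A
    simp only [CSI.delay, pow_one]
    exact this

lemma sum_pathProb_delay (k : Fin (K + 1)) (hk : csi.delay ≤ k) (A : Fin m → Fin m → ℝ) :
    ∑ x, F.pathProb K x * A (x (delayedTime csi k)) (x k) =
      ∑ i, ∑ j, F.pairProb csi i j * A i j := by
  have h := F.sum_pathProb_markov_delay k hk (G := fun _ => 1) (fun _ _ _ => rfl) A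
  simp only [one_mul] at h
  rw [h, F.sum_pathProb_apply K (delayedTime csi k) fun i =>
    ∑ j, (F.trans ^ csi.delay) i j * A i j]
  simp only [pairProb, Finset.mul_sum, mul_assoc]

variable (c : FeedbackCode m csi M K)

/-- The probability of a decoding error given the message `w` and the states `x`. -/
noncomputable def condErrorProb (w : Fin M) (x : Fin (K + 1) → Fin m) : ℝ :=
  (noiseLaw (K + 1)).real {z | c.dec (fun k => F.output c w x z k k.2) x ≠ w}

/-- The power of the input at time `k`, given the states. -/
noncomputable def condPower (k : Fin (K + 1)) (x : Fin (K + 1) → Fin m) : ℝ :=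
  (M : ℝ)⁻¹ * ∑ w, ∫ z, F.input c w x z k ^ 2 ∂(noiseLaw (K + 1))

lemma condPower_nonneg (k : Fin (K + 1)) (x : Fin (K + 1) → Fin m) : 0 ≤ F.condPower c k x :=
  mul_nonneg (by positivity) (Finset.sum_nonneg fun _ _ => integral_nonneg fun _ => sq_nonneg _)

lemma condPower_congr (k : Fin (K + 1)) {x x' : Fin (K + 1) → Fin m}
    (hx : ∀ i : Fin (K + 1), (i : ℕ) < k + 1 - csi.delay → x i = x' i) :
    F.condPower c k x = F.condPower c k x' := by
  simp only [condPower, F.input_congr c _ k hx fun _ _ => rfl]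

lemma messages_pos (F : GaussianFSMC m) (c : FeedbackCode m csi M K) : 0 < M := by
  obtain ⟨i⟩ := F.nonempty_states
  exact (c.dec (fun _ => 0) (fun _ => i)).pos

lemma measurableSet_error (w : Fin M) (x : Fin (K + 1) → Fin m) :
    MeasurableSet {z | c.dec (fun k => F.output c w x z k k.2) x ≠ w} := by
  have h : Measurable fun z => c.dec (fun k => F.output c w x z k k.2) x :=
    (c.measurable_dec x).comp (measurable_pi_iff.2 fun k => F.measurable_output c w x k k.2)
  exact (h (measurableSet_singleton w)).compl

lemma errorProb_eq_lintegral : F.errorProb c = ∑ x, ENNReal.ofReal (F.pathProb K x) *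
    ((M : ℝ≥0∞)⁻¹ * ∑ w, noiseLaw (K + 1)
      {z | c.dec (fun k => F.output c w x z k k.2) x ≠ w}) := by
  have hsec : ∀ w x, Measurable fun z => Set.indicator {ω : Fin M × (Fin (K + 1) → Fin m) ×
      (Fin (K + 1) → ℝ) | c.dec (fun k => F.output c ω.1 ω.2.1 ω.2.2 k k.2) ω.2.1 ≠ ω.1}
        (fun _ => (1 : ℝ≥0∞)) (w, x, z) := fun w x =>
    Measurable.indicator measurable_const (F.measurableSet_error c w x)
  have hset : MeasurableSet {ω : Fin M × (Fin (K + 1) → Fin m) × (Fin (K + 1) → ℝ) |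
      c.dec (fun k => F.output c ω.1 ω.2.1 ω.2.2 k k.2) ω.2.1 ≠ ω.1} := by
    have hm : Measurable fun ω : Fin M × (Fin (K + 1) → Fin m) × (Fin (K + 1) → ℝ) =>
        c.dec (fun k => F.output c ω.1 ω.2.1 ω.2.2 k k.2) ω.2.1 :=
      measurable_from_prod_countable_right fun w => measurable_from_prod_countable_right fun x =>
        (c.measurable_dec x).comp (measurable_pi_iff.2 fun k => F.measurable_output c w x k k.2)
    exact (measurableSet_eq_fun hm measurable_fst).compl
  rw [errorProb, ← lintegral_indicator_one hset]
  refine (F.lintegral_law M K hsec).trans ?_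
  refine Finset.sum_congr rfl fun x _ => ?_
  congr 2
  refine Finset.sum_congr rfl fun w _ => ?_
  rw [← lintegral_indicator_one (F.measurableSet_error c w x)]
  rfl

lemma errorProb_eq : F.errorProb c = ENNReal.ofReal
    (∑ x, F.pathProb K x * ((M : ℝ)⁻¹ * ∑ w, F.condErrorProb c w x)) := by
  have hM : (0 : ℝ) < M := by exact_mod_cast F.messages_pos c
  have h0 : ∀ x, 0 ≤ (M : ℝ)⁻¹ * ∑ w, F.condErrorProb c w x := fun x =>
    mul_nonneg (by positivity) (Finset.sum_nonneg fun _ _ => measureReal_nonneg)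
  rw [errorProb_eq_lintegral, ENNReal.ofReal_sum_of_nonneg fun x _ =>
    mul_nonneg (F.pathProb_nonneg K x) (h0 x)]
  refine Finset.sum_congr rfl fun x _ => ?_
  rw [ENNReal.ofReal_mul (F.pathProb_nonneg K x), ENNReal.ofReal_mul (by positivity),
    ENNReal.ofReal_inv_of_pos hM, ENNReal.ofReal_natCast,
    ENNReal.ofReal_sum_of_nonneg (f := fun w => F.condErrorProb c w x)
      fun _ _ => measureReal_nonneg]
  congr 2
  exact Finset.sum_congr rfl fun w _ => (ofReal_measureReal).symm

/-- The mean power of the inputs, as a sum of lower integrals over the noise. -/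
lemma PowerConstraint.sum_le {P : ℝ} (hc : F.PowerConstraint c P) :
    ∑ k, ∑ x, ENNReal.ofReal (F.pathProb K x) * ((M : ℝ≥0∞)⁻¹ * ∑ w,
      ∫⁻ z, ENNReal.ofReal (F.input c w x z k ^ 2) ∂(noiseLaw (K + 1))) ≤
      ENNReal.ofReal (((K + 1 : ℕ) : ℝ) * P) := by
  rw [PowerConstraint, ENNReal.div_le_iff (by simp) (by simp)] at hc
  rw [ENNReal.ofReal_mul (by positivity), ENNReal.ofReal_natCast, mul_comm]
  refine le_of_eq_of_le (Finset.sum_congr rfl fun k _ => ?_) hc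
  rw [F.lintegral_law M K (H := fun ω => ENNReal.ofReal (F.input c ω.1 ω.2.1 ω.2.2 k ^ 2))]
  exact fun w x => ((F.measurable_input c w x k).pow_const 2).ennreal_ofReal

/-- Only paths of positive probability are controlled: elsewhere the conditional power carries zero
weight in the constraint and may be infinite. -/
lemma PowerConstraint.memLp {P : ℝ} (hc : F.PowerConstraint c P) {x : Fin (K + 1) → Fin m}
    (hx : 0 < F.pathProb K x) (w : Fin M) (k : Fin (K + 1)) :
    MemLp (fun z => F.input c w x z k) 2 (noiseLaw (K + 1)) := by
  have hm := F.measurable_input c w x k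
  rw [memLp_two_iff_integrable_sq hm.aestronglyMeasurable]
  refine ⟨(hm.pow_const 2).aestronglyMeasurable, ?_⟩
  rw [hasFiniteIntegral_iff_ofReal (ae_of_all _ fun u => sq_nonneg _), lt_top_iff_ne_top]
  intro htop
  have h := hc.sum_le F c
  have h1 := (Finset.single_le_sum (f := fun k => ∑ x, ENNReal.ofReal (F.pathProb K x) *
    ((M : ℝ≥0∞)⁻¹ * ∑ w, ∫⁻ z, ENNReal.ofReal (F.input c w x z k ^ 2) ∂(noiseLaw (K + 1))))
    (fun _ _ => zero_le) (Finset.mem_univ k)).trans h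
  have h2 := (Finset.single_le_sum (f := fun x => ENNReal.ofReal (F.pathProb K x) *
    ((M : ℝ≥0∞)⁻¹ * ∑ w, ∫⁻ z, ENNReal.ofReal (F.input c w x z k ^ 2) ∂(noiseLaw (K + 1))))
    (fun _ _ => zero_le) (Finset.mem_univ x)).trans h1
  have h3 : ∑ w, ∫⁻ z, ENNReal.ofReal (F.input c w x z k ^ 2) ∂(noiseLaw (K + 1)) = ∞ :=
    ENNReal.sum_eq_top.2 ⟨w, Finset.mem_univ w, htop⟩
  simp only [h3] at h2
  rw [ENNReal.mul_top (by simp), ENNReal.mul_top (by simpa using hx), top_le_iff] at h2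
  exact ENNReal.ofReal_ne_top h2

lemma PowerConstraint.sum_condPower_le {P : ℝ} (hP : 0 ≤ P) (hc : F.PowerConstraint c P) :
    ∑ k, ∑ x, F.pathProb K x * F.condPower c k x ≤ ((K : ℝ) + 1) * P := by
  have hM : (0 : ℝ) < M := by exact_mod_cast F.messages_pos c
  have h0 : ∀ k x, 0 ≤ F.pathProb K x * F.condPower c k x := fun k x =>
    mul_nonneg (F.pathProb_nonneg K x) (F.condPower_nonneg c k x)
  have h := hc.sum_le F c
  push_cast at h
  rw [← ENNReal.ofReal_le_ofReal_iff (by positivity),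
    ENNReal.ofReal_sum_of_nonneg fun k _ => Finset.sum_nonneg fun x _ => h0 k x]
  refine le_of_eq_of_le (Finset.sum_congr rfl fun k _ => ?_) h
  rw [ENNReal.ofReal_sum_of_nonneg fun x _ => h0 k x]
  refine Finset.sum_congr rfl fun x _ => ?_
  rcases (F.pathProb_nonneg K x).eq_or_lt with hx | hx
  · simp [← hx]
  rw [ENNReal.ofReal_mul hx.le, condPower, ENNReal.ofReal_mul (by positivity),
    ENNReal.ofReal_inv_of_pos hM, ENNReal.ofReal_natCast,
    ENNReal.ofReal_sum_of_nonneg fun _ _ => integral_nonneg fun _ => sq_nonneg _]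
  congr 2
  refine Finset.sum_congr rfl fun w _ => ?_
  exact ofReal_integral_eq_lintegral_ofReal (hc.memLp F c hx w k).integrable_sq
    (ae_of_all _ fun _ => sq_nonneg _)

lemma integral_gaussianLLR_output (w : Fin M) (x : Fin (K + 1) → Fin m) (k : Fin (K + 1))
    (hL : MemLp (fun z => F.input c w x z k) 2 (noiseLaw (K + 1))) (v : ℝ≥0) :
    Integrable (fun z => gaussianLLR v (F.gain (x k) * F.input c w x z k)
      (F.output c w x z k k.2)) (noiseLaw (K + 1)) ∧
    ∫ z, gaussianLLR v (F.gain (x k) * F.input c w x z k) (F.output c w x z k k.2)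
      ∂(noiseLaw (K + 1)) = 1 / 2 * Real.log v +
        (F.gain (x k) ^ 2 * ∫ z, F.input c w x z k ^ 2 ∂(noiseLaw (K + 1)) + 1) / (2 * v)
          - 1 / 2 := by
  have e : ∀ z, gaussianLLR v (F.gain (x k) * F.input c w x z k) (F.output c w x z k k.2) =
      1 / 2 * Real.log v + 1 / (2 * v) * (F.gain (x k) * F.input c w x z k + 1 * z k) ^ 2 -
        1 / 2 * z k ^ 2 := by
    intro z
    rw [output_eq, gaussianLLR]
    ring
  have hs : MemLp (fun z => F.gain (x k) * F.input c w x z k + 1 * z k) 2 (noiseLaw (K + 1)) :=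
    (hL.const_mul _).add ((memLp_noise k).const_mul _)
  have i1 : Integrable (fun z => 1 / (2 * (v : ℝ)) *
      (F.gain (x k) * F.input c w x z k + 1 * z k) ^ 2) (noiseLaw (K + 1)) :=
    hs.integrable_sq.const_mul _
  have i2 : Integrable (fun z : Fin (K + 1) → ℝ => 1 / 2 * z k ^ 2) (noiseLaw (K + 1)) :=
    (memLp_noise k).integrable_sq.const_mul _
  have i3 : Integrable (fun z => 1 / 2 * Real.log v + 1 / (2 * (v : ℝ)) *
      (F.gain (x k) * F.input c w x z k + 1 * z k) ^ 2) (noiseLaw (K + 1)) :=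
    (integrable_const _).add i1
  simp only [e]
  refine ⟨i3.sub i2, ?_⟩
  rw [integral_sub i3 i2, integral_add (integrable_const _) i1, integral_const,
    integral_const_mul, integral_const_mul, integral_noise_sq, integral_sq_add_noise k (F.measurable_input c w x k)
      (fun z z' h => F.input_congr c w k (fun _ _ => rfl) h) hL]
  simp
  ring

/-- For given states, the number of messages is controlled by the log-likelihood ratio between the
outputs and independent centred Gaussian variables. -/
lemma sum_correct_mul_log_le (x : Fin (K + 1) → Fin m)
    (hL : ∀ w k, MemLp (fun z => F.input c w x z k) 2 (noiseLaw (K + 1)))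
    {v : ℕ → ℝ≥0} (hv : ∀ k, v k ≠ 0) :
    (1 - (M : ℝ)⁻¹ * ∑ w, F.condErrorProb c w x) * Real.log M ≤
      Real.log 2 + ∑ k : Fin (K + 1), (1 / 2 * Real.log (v k) +
        (F.gain (x k) ^ 2 * F.condPower c k x + 1) / (2 * v k) - 1 / 2) := by
  classical
  have hM : (0 : ℝ) < M := by exact_mod_cast F.messages_pos c
  have hM1 : (1 : ℝ) ≤ M := by exact_mod_cast F.messages_pos c
  set Q := Measure.pi fun k : Fin (K + 1) => gaussianReal 0 (v k)
  let D : Fin M → Set (Fin (K + 1) → ℝ) := fun w => {y | c.dec y x = w}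
  have hD : ∀ w, MeasurableSet (D w) := fun w => c.measurable_dec x (measurableSet_singleton w)
  -- Equal to M on the decoding region of `w` and to 1 elsewhere, so the mean of its logarithm along
  -- the true outputs is the probability of correct decoding times log M.
  let h : Fin M → (Fin (K + 1) → ℝ) → ℝ := fun w y => 1 + (D w).indicator (fun _ => (M : ℝ) - 1) y
  have hpos : ∀ w y, 1 ≤ h w y := fun w y =>
    le_add_of_nonneg_right (Set.indicator_nonneg (fun _ _ => sub_nonneg.2 hM1) _)
  have hhm : ∀ w, Measurable (h w) := fun w =>
    measurable_const.add (measurable_const.indicator (hD w))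
  let Y : Fin M → (Fin (K + 1) → ℝ) → Fin (K + 1) → ℝ := fun w z k => F.output c w x z k k.2
  have hY : ∀ w, Measurable (Y w) := fun w =>
    measurable_pi_iff.2 fun k => F.measurable_output c w x k k.2
  let L : Fin M → (Fin (K + 1) → ℝ) → ℝ := fun w z => ∑ k : Fin (K + 1), gaussianLLR (v k)
    (F.gain (x k) * F.input c w x z k) (F.output c w x z k k.2)
  have hLm : ∀ w, Measurable (L w) := fun w => Finset.measurable_sum _ fun k _ =>
    (measurable_gaussianLLR (v k)).comp
      (((F.measurable_input c w x k).const_mul _).prodMk (F.measurable_output c w x k k.2))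
  have hLi : ∀ w, Integrable (L w) (noiseLaw (K + 1)) := fun w =>
    integrable_finsetSum _ fun k _ => (F.integral_gaussianLLR_output c w x k (hL w k) (v k)).1
  have hhQ : ∀ w, ∫ y, h w y ∂Q = 1 + (M - 1) * Q.real (D w) := by
    intro w
    rw [integral_add (integrable_const _) ((integrable_const _).indicator (hD w)),
      integral_indicator_const _ (hD w)]
    simp [mul_comm]
  have hhi : ∀ w, Integrable (h w) Q := fun w =>
    (integrable_const _).add ((integrable_const _).indicator (hD w))
  have hlint : ∀ w, ∫⁻ z, ENNReal.ofReal (Real.exp (-L w z) * h w (Y w z)) ∂(noiseLaw (K + 1)) =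
      ENNReal.ofReal (∫ y, h w y ∂Q) := by
    intro w
    rw [ofReal_integral_eq_lintegral_ofReal (hhi w)
      (ae_of_all _ fun y => zero_le_one.trans (hpos w y)),
      ← F.lintegral_exp_neg_sum_output c w x hv (hhm w).ennreal_ofReal]
    exact lintegral_congr fun z => ENNReal.ofReal_mul (Real.exp_nonneg _)
  have hEm : ∀ w, Measurable fun z => Real.exp (-L w z) * h w (Y w z) := fun w =>
    (hLm w).neg.exp.mul ((hhm w).comp (hY w))
  have hE0 : ∀ w z, 0 ≤ Real.exp (-L w z) * h w (Y w z) := fun w z =>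
    mul_nonneg (Real.exp_nonneg _) (zero_le_one.trans (hpos w _))
  have hEi : ∀ w, Integrable (fun z => Real.exp (-L w z) * h w (Y w z)) (noiseLaw (K + 1)) := by
    intro w
    refine ⟨(hEm w).aestronglyMeasurable, ?_⟩
    rw [hasFiniteIntegral_iff_ofReal (ae_of_all _ (hE0 w)), hlint]
    exact ENNReal.ofReal_lt_top
  have hEint : ∀ w, ∫ z, Real.exp (-L w z) * h w (Y w z) ∂(noiseLaw (K + 1)) =
      1 + (M - 1) * Q.real (D w) := by
    intro w
    rw [integral_eq_lintegral_of_nonneg_ae (ae_of_all _ (hE0 w)) (hEm w).aestronglyMeasurable,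
      hlint, ENNReal.toReal_ofReal, hhQ]
    exact integral_nonneg fun y => zero_le_one.trans (hpos w y)
  have hset : ∀ w, MeasurableSet (Y w ⁻¹' D w) := fun w => hY w (hD w)
  -- This is log t ≤ t/2 − 1 + log 2 with t = e^{-L} h, a linear substitute for Jensen's inequality;
  -- it is tangent at t = 2, an upper bound for the mean of t averaged over messages.
  have hpt : ∀ w z, (Y w ⁻¹' D w).indicator (fun _ => Real.log M) z - L w z ≤
      1 / 2 * (Real.exp (-L w z) * h w (Y w z)) + (Real.log 2 - 1) := by
    intro w z
    have e1 : (Y w ⁻¹' D w).indicator (fun _ => Real.log M) z = Real.log (h w (Y w z)) := by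
      by_cases hz : Y w z ∈ D w
      · rw [Set.indicator_of_mem (show z ∈ Y w ⁻¹' D w from hz)]
        simp only [h]
        rw [Set.indicator_of_mem hz]
        congr 1
        ring
      · rw [Set.indicator_of_notMem (show z ∉ Y w ⁻¹' D w from hz)]
        simp only [h]
        rw [Set.indicator_of_notMem hz]
        simp
    have hp : 0 < h w (Y w z) := zero_lt_one.trans_le (hpos w _)
    have hexp := Real.exp_pos (-L w z)
    have h1 := Real.log_le_sub_one_of_pos (show 0 < Real.exp (-L w z) * h w (Y w z) / 2 by positivity)
    rw [Real.log_div (by positivity) (by norm_num), Real.log_mul hexp.ne' hp.ne',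
      Real.log_exp] at h1
    rw [e1]
    linarith
  have hcorr : ∀ w, (noiseLaw (K + 1)).real (Y w ⁻¹' D w) = 1 - F.condErrorProb c w x := by
    intro w
    have : Y w ⁻¹' D w = {z | c.dec (fun k => F.output c w x z k k.2) x ≠ w}ᶜ := by
      ext z; simp [Y, D]
    rw [this, probReal_compl_eq_one_sub (F.measurableSet_error c w x), condErrorProb]
  have hLint : ∀ w, ∫ z, L w z ∂(noiseLaw (K + 1)) = ∑ k : Fin (K + 1), (1 / 2 * Real.log (v k) +
      (F.gain (x k) ^ 2 * ∫ z, F.input c w x z k ^ 2 ∂(noiseLaw (K + 1)) + 1) / (2 * v k)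
        - 1 / 2) := by
    intro w
    rw [integral_finsetSum _ fun k _ => (F.integral_gaussianLLR_output c w x k (hL w k) (v k)).1]
    exact Finset.sum_congr rfl fun k _ => (F.integral_gaussianLLR_output c w x k (hL w k) (v k)).2
  have hw : ∀ w, (1 - F.condErrorProb c w x) * Real.log M -
      ∑ k : Fin (K + 1), (1 / 2 * Real.log (v k) +
      (F.gain (x k) ^ 2 * ∫ z, F.input c w x z k ^ 2 ∂(noiseLaw (K + 1)) + 1) / (2 * v k)
        - 1 / 2) ≤ 1 / 2 * (1 + (M - 1) * Q.real (D w)) + (Real.log 2 - 1) := by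
    intro w
    have i1 : Integrable ((Y w ⁻¹' D w).indicator fun _ => Real.log M) (noiseLaw (K + 1)) :=
      (integrable_const _).indicator (hset w)
    have i2 := (hEi w).const_mul (1 / 2)
    have hmono := integral_mono (i1.sub (hLi w)) (i2.add (integrable_const (Real.log 2 - 1)))
      (hpt w)
    rw [integral_sub' i1 (hLi w), integral_indicator_const _ (hset w), hcorr, hLint,
      integral_add' i2 (integrable_const _), integral_const_mul, hEint] at hmono
    simpa using hmono
  -- The law `Q` is the same for all messages and the decoding regions partition the space.
  have hDsum : ∑ w, Q.real (D w) = 1 := by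
    rw [← measureReal_iUnion_fintype _ hD]
    · have : ⋃ w, D w = Set.univ := by ext y; simp [D]
      rw [this, probReal_univ]
    · intro a b hab
      refine Set.disjoint_left.2 fun y hy hy' => hab ?_
      simp only [D, Set.mem_ofPred_eq] at hy hy'
      rw [← hy, hy']
  have hsum := Finset.sum_le_sum fun w (_ : w ∈ Finset.univ) => hw w
  simp only [Finset.sum_sub_distrib, Finset.sum_add_distrib, ← Finset.mul_sum, ← Finset.sum_mul,
    hDsum, Finset.sum_const, Finset.card_univ, Fintype.card_fin, nsmul_eq_mul, mul_one] at hsum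
  rw [Finset.sum_comm] at hsum
  have hpw : ∀ k : Fin (K + 1), ∑ w, (F.gain (x k) ^ 2 *
      ∫ z, F.input c w x z k ^ 2 ∂(noiseLaw (K + 1)) + 1) / (2 * (v k : ℝ)) =
      M * ((F.gain (x k) ^ 2 * F.condPower c k x + 1) / (2 * v k)) := by
    intro k
    rw [← Finset.sum_div, Finset.sum_add_distrib, ← Finset.mul_sum, condPower]
    simp only [Finset.sum_const, Finset.card_univ, Fintype.card_fin, nsmul_eq_mul, mul_one]
    field_simp
  simp only [hpw, ← Finset.mul_sum] at hsum
  simp only [Finset.sum_sub_distrib, Finset.sum_add_distrib, ← Finset.mul_sum,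
    Finset.sum_const, Finset.card_univ, Fintype.card_fin, nsmul_eq_mul]
  set E := ∑ w, F.condErrorProb c w x
  set S1 := ∑ k : Fin (K + 1), Real.log (v k)
  set S2 := ∑ k : Fin (K + 1), (F.gain (x k) ^ 2 * F.condPower c k x + 1) / (2 * (v k : ℝ))
  refine le_of_mul_le_mul_left ?_ hM
  have e1 : (M : ℝ) * ((1 - (M : ℝ)⁻¹ * E) * Real.log M) = (M - E) * Real.log M := by
    field_simp
  rw [e1]
  linarith

/-- The converse for a single code. -/
lemma PowerConstraint.log_le {P : ℝ} (hP : 0 ≤ P) {Γ : Fin m → ℝ}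
    (hΓ : F.IsOptimalAllocation csi P Γ) (hc : F.PowerConstraint c P) :
    (1 - (F.errorProb c).toReal) * Real.log M ≤
      ((K : ℝ) + 1) * F.allocationRate csi Γ + Real.log 2 +
        1 / 2 * Real.log (1 + (∑ i, F.gain i ^ 2) * P * ((K : ℝ) + 1)) +
        1 / 2 * ∑ i, F.stat i * F.marginalGain csi Γ i * Γ i := by
  classical
  obtain ⟨l, hl0, hl, hlP⟩ := hΓ.exists_multiplier F hP
  set Λ := ∑ i, F.stat i * F.marginalGain csi Γ i * Γ i
  have hΛ : 0 ≤ Λ := (mul_nonneg hl0 hP).trans hlP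
  set C := F.allocationRate csi Γ
  have hC : 0 ≤ C := F.allocationRate_nonneg csi hΓ.1.1
  set B := ∑ i, F.gain i ^ 2
  have hB0 : 0 ≤ B := Finset.sum_nonneg fun i _ => sq_nonneg _
  have hB : ∀ i, F.gain i ^ 2 ≤ B := fun i =>
    Finset.single_le_sum (f := fun i => F.gain i ^ 2) (fun i _ => sq_nonneg _) (Finset.mem_univ i)
  have hK : (0 : ℝ) < (K : ℝ) + 1 := by positivity
  have hpos : ∀ i j, 0 < 1 + F.gain j ^ 2 * Γ i := fun i j => by
    have := mul_nonneg (sq_nonneg (F.gain j)) (hΓ.1.1 i); linarith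
  set V := 1 + B * P * ((K : ℝ) + 1)
  have hV : 1 ≤ V := by
    have : 0 ≤ B * P * ((K : ℝ) + 1) := by positivity
    linarith
  -- Reference output variances. At time 0 with delayed information there is no state to allocate
  -- by, and that input might use the whole budget (K + 1) P; the crude `V` covers this at only
  -- logarithmic cost.
  let ν : (Fin (K + 1) → Fin m) → Fin (K + 1) → ℝ := fun x k =>
    if csi.delay ≤ k then 1 + F.gain (x k) ^ 2 * Γ (x (delayedTime csi k)) else V
  have hν : ∀ x k, 0 < ν x k := by
    intro x k
    simp only [ν]
    split_ifs
    · exact hpos _ _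
    · linarith
  let v : (Fin (K + 1) → Fin m) → ℕ → ℝ≥0 := fun x k =>
    if h : k < K + 1 then (ν x ⟨k, h⟩).toNNReal else 1
  have hv : ∀ x k, v x k ≠ 0 := by
    intro x k
    simp only [v]
    split_ifs
    · simpa using hν x _
    · exact one_ne_zero
  have hvν : ∀ x (k : Fin (K + 1)), (v x k : ℝ) = ν x k := by
    intro x k
    simp only [v, k.2, dite_true, Fin.eta]
    exact Real.coe_toNNReal _ (hν x k).le
  let U : Fin (K + 1) → ℝ := fun k => ∑ x, F.pathProb K x * F.condPower c k x
  have hU0 : ∀ k, 0 ≤ U k := fun k => Finset.sum_nonneg fun x _ =>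
    mul_nonneg (F.pathProb_nonneg K x) (F.condPower_nonneg c k x)
  have hU : ∑ k, U k ≤ ((K : ℝ) + 1) * P := hc.sum_condPower_le F c hP
  let T : (Fin (K + 1) → Fin m) → Fin (K + 1) → ℝ := fun x k => 1 / 2 * Real.log (ν x k) +
    (F.gain (x k) ^ 2 * F.condPower c k x + 1) / (2 * ν x k) - 1 / 2
  have hlogV : 0 ≤ Real.log V := Real.log_nonneg hV
  -- After summation over `k`, the terms l U_k − Λ total at most (K + 1)(l P − Λ) ≤ 0. The extra Λ /
  -- 2 at `k = 0` cancels the −Λ / 2 that the crude bound there does not produce.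
  have hterm : ∀ k, ∑ x, F.pathProb K x * T x k ≤ C + 1 / 2 * (l * U k - Λ) +
      if k = 0 then 1 / 2 * Real.log V + 1 / 2 * Λ else 0 := by
    intro k
    by_cases hk : csi.delay ≤ k
    · have e1 : ∀ x, T x k = 1 / 2 * Real.log (1 + F.gain (x k) ^ 2 * Γ (x (delayedTime csi k))) +
          1 / 2 * (F.condPower c k x * (F.gain (x k) ^ 2 /
            (1 + F.gain (x k) ^ 2 * Γ (x (delayedTime csi k))))) -
          1 / 2 * (F.gain (x k) ^ 2 / (1 + F.gain (x k) ^ 2 * Γ (x (delayedTime csi k))) *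
            Γ (x (delayedTime csi k))) := by
        intro x
        have := (hpos (x (delayedTime csi k)) (x k)).ne'
        simp only [T, ν, hk, if_true]
        field_simp
        ring
      have h1 := F.sum_pathProb_delay k hk fun i j => Real.log (1 + F.gain j ^ 2 * Γ i)
      have h2 := F.sum_pathProb_markov_delay k hk (G := F.condPower c k)
        (fun x x' h => F.condPower_congr c k h) fun i j => F.gain j ^ 2 / (1 + F.gain j ^ 2 * Γ i)
      have h3 := F.sum_pathProb_delay k hk fun i j =>
        F.gain j ^ 2 / (1 + F.gain j ^ 2 * Γ i) * Γ i
      have h4 : ∑ i, ∑ j, F.pairProb csi i j * (F.gain j ^ 2 / (1 + F.gain j ^ 2 * Γ i) * Γ i) =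
          Λ := by
        refine Finset.sum_congr rfl fun i _ => ?_
        rw [stat_mul_marginalGain, Finset.sum_mul]
        exact Finset.sum_congr rfl fun j _ => by ring
      have h5 : ∑ x, F.pathProb K x * (F.condPower c k x *
          ∑ j, (F.trans ^ csi.delay) (x (delayedTime csi k)) j *
            (F.gain j ^ 2 / (1 + F.gain j ^ 2 * Γ (x (delayedTime csi k))))) ≤ l * U k := by
        simp only [U, Finset.mul_sum (a := l)]
        refine Finset.sum_le_sum fun x _ => ?_
        have := mul_le_mul_of_nonneg_left (hl (x (delayedTime csi k)))
          (mul_nonneg (F.pathProb_nonneg K x) (F.condPower_nonneg c k x))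
        simp only [marginalGain] at this
        linarith
      have hC' : C = 1 / 2 * ∑ i, ∑ j, F.pairProb csi i j * Real.log (1 + F.gain j ^ 2 * Γ i) := rfl
      have hite : (0 : ℝ) ≤ if k = 0 then 1 / 2 * Real.log V + 1 / 2 * Λ else 0 := by
        split_ifs <;> positivity
      have e2 : ∑ x, F.pathProb K x * T x k =
          1 / 2 * (∑ x, F.pathProb K x *
            Real.log (1 + F.gain (x k) ^ 2 * Γ (x (delayedTime csi k)))) +
          1 / 2 * (∑ x, F.pathProb K x * (F.condPower c k x * (F.gain (x k) ^ 2 /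
            (1 + F.gain (x k) ^ 2 * Γ (x (delayedTime csi k)))))) -
          1 / 2 * ∑ x, F.pathProb K x * (F.gain (x k) ^ 2 /
            (1 + F.gain (x k) ^ 2 * Γ (x (delayedTime csi k))) * Γ (x (delayedTime csi k))) := by
        rw [Finset.mul_sum, Finset.mul_sum, Finset.mul_sum, ← Finset.sum_add_distrib,
          ← Finset.sum_sub_distrib]
        refine Finset.sum_congr rfl fun x _ => ?_
        rw [e1]
        ring
      rw [e2, h1, h2, h3, h4]
      linarith
    · have hk0 : k = 0 := by
        have : csi.delay ≤ 1 := by cases csi <;> simp [CSI.delay]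
        exact Fin.ext (show (k : ℕ) = 0 by omega)
      have hUk : U k ≤ ((K : ℝ) + 1) * P :=
        (Finset.single_le_sum (fun k _ => hU0 k) (Finset.mem_univ k)).trans hU
      have h1 : ∑ x, F.pathProb K x * T x k ≤
          1 / 2 * Real.log V + (B * U k + 1) / (2 * V) - 1 / 2 := by
        calc _ ≤ ∑ x, (F.pathProb K x * (1 / 2 * Real.log V + 1 / (2 * V) - 1 / 2) +
              B / (2 * V) * (F.pathProb K x * F.condPower c k x)) := by
              refine Finset.sum_le_sum fun x _ => ?_
              have h2 : T x k ≤ 1 / 2 * Real.log V + 1 / (2 * V) - 1 / 2 +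
                  B / (2 * V) * F.condPower c k x := by
                simp only [T, ν, hk, if_false, add_div]
                have := mul_le_mul_of_nonneg_right (hB (x k)) (F.condPower_nonneg c k x)
                have h3 : F.gain (x k) ^ 2 * F.condPower c k x / (2 * V) ≤
                    B * F.condPower c k x / (2 * V) := by gcongr
                have h4 : B * F.condPower c k x / (2 * V) = B / (2 * V) * F.condPower c k x := by
                  ring
                linarith
              have := mul_le_mul_of_nonneg_left h2 (F.pathProb_nonneg K x)
              linarith
          _ = _ := by
              rw [Finset.sum_add_distrib, ← Finset.sum_mul, F.sum_pathProb, ← Finset.mul_sum]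
              simp only [U]
              ring
      -- `V` was chosen to dominate 1 + B U_0 even when all power is spent at time 0.
      have h2 : (B * U k + 1) / (2 * V) ≤ 1 / 2 := by
        rw [div_le_iff₀ (by linarith)]
        have := mul_le_mul_of_nonneg_left hUk hB0
        simp only [V]
        linarith
      rw [if_pos hk0]
      have := mul_nonneg hl0 (hU0 k)
      linarith
  have hcode : ∀ x, F.pathProb K x *
      ((1 - (M : ℝ)⁻¹ * ∑ w, F.condErrorProb c w x) * Real.log M) ≤
      F.pathProb K x * (Real.log 2 + ∑ k, T x k) := by
    intro x
    -- Null paths are discarded, since square integrability of the inputs may fail on them.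
    rcases (F.pathProb_nonneg K x).eq_or_lt with hx | hx
    · simp [← hx]
    · refine mul_le_mul_of_nonneg_left ?_ hx.le
      have := F.sum_correct_mul_log_le c x (fun w k => hc.memLp F c hx w k) (hv x)
      simpa only [hvν] using this
  have herr : (F.errorProb c).toReal =
      ∑ x, F.pathProb K x * ((M : ℝ)⁻¹ * ∑ w, F.condErrorProb c w x) := by
    rw [errorProb_eq, ENNReal.toReal_ofReal]
    exact Finset.sum_nonneg fun x _ => mul_nonneg (F.pathProb_nonneg K x)
      (mul_nonneg (by positivity) (Finset.sum_nonneg fun _ _ => measureReal_nonneg))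
  calc (1 - (F.errorProb c).toReal) * Real.log M
      = ∑ x, F.pathProb K x *
        ((1 - (M : ℝ)⁻¹ * ∑ w, F.condErrorProb c w x) * Real.log M) := by
        simp only [← mul_assoc, ← Finset.sum_mul, mul_sub, mul_one, Finset.sum_sub_distrib,
          F.sum_pathProb, herr]
    _ ≤ ∑ x, F.pathProb K x * (Real.log 2 + ∑ k, T x k) := Finset.sum_le_sum fun x _ => hcode x
    _ = Real.log 2 + ∑ k, ∑ x, F.pathProb K x * T x k := by
        rw [Finset.sum_comm]
        simp only [mul_add, Finset.sum_add_distrib, ← Finset.sum_mul, F.sum_pathProb, one_mul,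
          Finset.mul_sum]
    _ ≤ Real.log 2 + ∑ k, (C + 1 / 2 * (l * U k - Λ) +
        if k = 0 then 1 / 2 * Real.log V + 1 / 2 * Λ else 0) := by
        gcongr with k _
        exact hterm k
    _ = Real.log 2 + (((K : ℝ) + 1) * C + 1 / 2 * (l * ∑ k, U k - ((K : ℝ) + 1) * Λ) +
        (1 / 2 * Real.log V + 1 / 2 * Λ)) := by
        simp only [Finset.sum_add_distrib, ← Finset.mul_sum, Finset.sum_sub_distrib,
          Finset.sum_const, Finset.card_univ, Fintype.card_fin, nsmul_eq_mul, Finset.sum_ite_eq',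
          Finset.mem_univ, if_true]
        push_cast
        rfl
    _ ≤ _ := by
        have h1 := mul_le_mul_of_nonneg_left hU hl0
        have h2 := mul_le_mul_of_nonneg_left hlP hK.le
        linarith

lemma tendsto_log_linear_div (a : ℝ) (ha : 0 ≤ a) :
    Tendsto (fun K : ℕ => Real.log (1 + a * ((K : ℝ) + 1)) / ((K : ℝ) + 1)) atTop (𝓝 0) := by
  have hn : Tendsto (fun K : ℕ => (K : ℝ) + 1) atTop atTop :=
    tendsto_atTop_add_const_right _ _ tendsto_natCast_atTop_atTop
  have h1 : Tendsto (fun K : ℕ => Real.log ((K : ℝ) + 1) / ((K : ℝ) + 1)) atTop (𝓝 0) :=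
    (Real.isLittleO_log_id_atTop.tendsto_div_nhds_zero).comp hn
  have h2 : Tendsto (fun K : ℕ => Real.log (1 + a) / ((K : ℝ) + 1)) atTop (𝓝 0) :=
    hn.const_div_atTop _
  have h3 := h2.add h1
  rw [add_zero] at h3
  refine squeeze_zero (fun K => ?_) (fun K => ?_) h3
  · have : 0 ≤ a * ((K : ℝ) + 1) := by positivity
    exact div_nonneg (Real.log_nonneg (by linarith)) (by positivity)
  · rw [← add_div, ← Real.log_mul (by positivity) (by positivity)]
    have : (0 : ℝ) ≤ K := K.cast_nonneg
    gcongr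
    linarith

/-- The converse: no rate above the optimal allocation rate is achievable. -/
lemma Achievable.le_allocationRate {P R : ℝ} (hP : 0 ≤ P) {Γ : Fin m → ℝ}
    (hΓ : F.IsOptimalAllocation csi P Γ) (hR : F.Achievable csi P R) :
    R ≤ F.allocationRate csi Γ := by
  obtain ⟨M, c, hpow, hrate, herr⟩ := hR
  set C := F.allocationRate csi Γ
  set B := (∑ i, F.gain i ^ 2) * P
  have hB : 0 ≤ B := mul_nonneg (Finset.sum_nonneg fun i _ => sq_nonneg _) hP
  set D := Real.log 2 + 1 / 2 * ∑ i, F.stat i * F.marginalGain csi Γ i * Γ i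
  refine le_of_forall_lt fun R' hR' => ?_
  -- A rate strictly below R turns the liminf condition into an eventual strict inequality.
  obtain ⟨R'', hR'', hR''R⟩ := exists_between hR'
  refine hR''.trans_le ?_
  have hlt : (R'' : EReal) < liminf (fun K : ℕ =>
      ((Real.log (M K) / ((K : ℝ) + 1) : ℝ) : EReal)) atTop :=
    (EReal.coe_lt_coe_iff.2 hR''R).trans_le hrate
  have hev := eventually_lt_of_lt_liminf hlt
  have hn : Tendsto (fun K : ℕ => (K : ℝ) + 1) atTop atTop :=
    tendsto_atTop_add_const_right _ _ tendsto_natCast_atTop_atTop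
  have herr' : Tendsto (fun K => (F.errorProb (c K)).toReal) atTop (𝓝 0) := by
    have h := (ENNReal.tendsto_toReal ENNReal.zero_ne_top).comp herr
    rwa [ENNReal.toReal_zero] at h
  have hleft : Tendsto (fun K => (1 - (F.errorProb (c K)).toReal) * R'') atTop (𝓝 R'') := by
    simpa using (herr'.const_sub 1).mul_const R''
  have hright : Tendsto (fun K : ℕ => C + 1 / 2 * (Real.log (1 + B * ((K : ℝ) + 1)) /
      ((K : ℝ) + 1)) + D / ((K : ℝ) + 1)) atTop (𝓝 C) := by
    have h := (((tendsto_log_linear_div B hB).const_mul (1 / 2)).const_add C).add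
      (hn.const_div_atTop D)
    rwa [mul_zero, add_zero, add_zero] at h
  refine le_of_tendsto_of_tendsto hleft hright ?_
  filter_upwards [hev, herr'.eventually_lt_const zero_lt_one] with K h1 h2
  have h3 : R'' < Real.log (M K) / ((K : ℝ) + 1) := EReal.coe_lt_coe_iff.1 h1
  have hK : (0 : ℝ) < (K : ℝ) + 1 := by positivity
  have h4 := (hpow K).log_le F (c K) hP hΓ
  have h5 : (1 - (F.errorProb (c K)).toReal) * R'' ≤
      (1 - (F.errorProb (c K)).toReal) * (Real.log (M K) / ((K : ℝ) + 1)) :=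
    mul_le_mul_of_nonneg_left h3.le (by linarith)
  refine h5.trans ?_
  rw [← mul_div_assoc, div_le_iff₀ hK]
  refine h4.trans (le_of_eq ?_)
  change ((K : ℝ) + 1) * C + Real.log 2 + 1 / 2 * Real.log (1 + B * ((K : ℝ) + 1)) +
    1 / 2 * (∑ i, F.stat i * F.marginalGain csi Γ i * Γ i) = _
  have e : D = Real.log 2 + 1 / 2 * (∑ i, F.stat i * F.marginalGain csi Γ i * Γ i) := rfl
  clear_value C B
  rw [e]
  field_simp
  ring

end GaussianFSMC

/-! ### Achievability by the Schalkwijk–Kailath scheme -/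

/-- The message `w` whose point `w / M` is closest to `t`. -/
noncomputable def nearestMessage {M : ℕ} (hM : 0 < M) (t : ℝ) : Fin M :=
  ⟨min ⌊M * t + 1 / 2⌋₊ (M - 1), by omega⟩

lemma measurable_nearestMessage {M : ℕ} (hM : 0 < M) : Measurable (nearestMessage hM) := by
  have h : nearestMessage hM = (fun n : ℕ => (⟨min n (M - 1), by omega⟩ : Fin M)) ∘
      fun t : ℝ => ⌊M * t + 1 / 2⌋₊ := rfl
  rw [h]
  exact (Measurable.of_discrete).comp (Nat.measurable_floor.comp (by fun_prop))

lemma nearestMessage_eq {M : ℕ} (hM : 0 < M) {t : ℝ} {w : Fin M}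
    (h : |(w : ℝ) / M - t| < 1 / (2 * M)) : nearestMessage hM t = w := by
  have hM' : (0 : ℝ) < M := by exact_mod_cast hM
  rw [abs_lt] at h
  have e1 : (M : ℝ) * ((w : ℝ) / M - t) = w - M * t := by field_simp
  have e2 : (M : ℝ) * (1 / (2 * M)) = 1 / 2 := by field_simp
  have h1 := mul_lt_mul_of_pos_left h.1 hM'
  have h2 := mul_lt_mul_of_pos_left h.2 hM'
  rw [mul_neg, e1, e2] at h1
  rw [e1, e2] at h2
  have hf : ⌊(M : ℝ) * t + 1 / 2⌋₊ = w := by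
    have hw : (0 : ℝ) ≤ (w : ℕ) := Nat.cast_nonneg _
    rw [Nat.floor_eq_iff (by linarith)]
    constructor <;> linarith
  apply Fin.ext
  have hval : (nearestMessage hM t : ℕ) = min ⌊(M : ℝ) * t + 1 / 2⌋₊ (M - 1) := rfl
  have := w.2
  rw [hval, hf]
  omega

namespace GaussianFSMC

variable {m : ℕ} (F : GaussianFSMC m) (csi : CSI) (Γ : Fin m → ℝ)

/-- The input power used at time `k`. -/
noncomputable def feedbackPower (ξ : ℕ → Fin m) (k : ℕ) : ℝ :=
  if csi.delay ≤ k then Γ (ξ (k - csi.delay)) else 0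

/-- The bound on the mean squared error of the estimate of the message before time `k`. -/
noncomputable def feedbackVar (ξ : ℕ → Fin m) : ℕ → ℝ
  | 0 => 1
  | k + 1 => feedbackVar ξ k / (1 + F.gain (ξ k) ^ 2 * feedbackPower csi Γ ξ k)

/-- The amplification of the estimation error at time `k`. -/
noncomputable def feedbackScale (ξ : ℕ → Fin m) (k : ℕ) : ℝ :=
  √(feedbackPower csi Γ ξ k / F.feedbackVar csi Γ ξ k)

/-- The coefficient of the output at time `k` in the linear estimate of the message. -/
noncomputable def estimatorCoeff (ξ : ℕ → Fin m) (k : ℕ) : ℝ :=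
  F.gain (ξ k) * F.feedbackScale csi Γ ξ k * F.feedbackVar csi Γ ξ k /
    (1 + F.gain (ξ k) ^ 2 * feedbackPower csi Γ ξ k)

variable {csi Γ}

lemma feedbackPower_nonneg (hΓ : ∀ i, 0 ≤ Γ i) (ξ : ℕ → Fin m) (k : ℕ) :
    0 ≤ feedbackPower csi Γ ξ k := by
  unfold feedbackPower
  split_ifs
  · exact hΓ _
  · exact le_rfl

lemma one_add_feedbackPower_pos (hΓ : ∀ i, 0 ≤ Γ i) (ξ : ℕ → Fin m) (k : ℕ) :
    0 < 1 + F.gain (ξ k) ^ 2 * feedbackPower csi Γ ξ k := by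
  have := mul_nonneg (sq_nonneg (F.gain (ξ k))) (feedbackPower_nonneg (csi := csi) hΓ ξ k)
  linarith

/-- Taking logarithms exposes an additive functional of the state path, to which the variance bound
for the chain applies. -/
lemma feedbackVar_eq_exp (hΓ : ∀ i, 0 ≤ Γ i) (ξ : ℕ → Fin m) (n : ℕ) :
    F.feedbackVar csi Γ ξ n = Real.exp (-∑ k : Fin n,
      Real.log (1 + F.gain (ξ k) ^ 2 * feedbackPower csi Γ ξ k)) := by
  induction n with
  | zero => simp [feedbackVar]
  | succ n ih =>
    rw [feedbackVar, ih, Fin.sum_univ_castSucc, neg_add, Real.exp_add,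
      Real.exp_neg (Real.log _)]
    simp only [Fin.val_castSucc, Fin.val_last]
    rw [Real.exp_log (F.one_add_feedbackPower_pos hΓ ξ n), div_eq_mul_inv]

lemma feedbackVar_pos (hΓ : ∀ i, 0 ≤ Γ i) (ξ : ℕ → Fin m) (n : ℕ) :
    0 < F.feedbackVar csi Γ ξ n := by
  rw [F.feedbackVar_eq_exp hΓ]; exact Real.exp_pos _

lemma delay_le_one : csi.delay ≤ 1 := by cases csi <;> simp [CSI.delay]

lemma feedbackPower_congr {ξ ξ' : ℕ → Fin m} {k : ℕ}
    (h : ∀ i < k + 1 - csi.delay, ξ i = ξ' i) :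
    feedbackPower csi Γ ξ k = feedbackPower csi Γ ξ' k := by
  unfold feedbackPower
  split_ifs with hk
  · rw [h _ (by omega)]
  · rfl

lemma feedbackVar_congr {ξ ξ' : ℕ → Fin m} {k : ℕ} (h : ∀ i < k, ξ i = ξ' i) :
    F.feedbackVar csi Γ ξ k = F.feedbackVar csi Γ ξ' k := by
  induction k with
  | zero => rfl
  | succ k ih =>
    rw [feedbackVar, feedbackVar, ih fun i hi => h i (by omega), h k (by omega),
      feedbackPower_congr fun i hi => h i (by omega)]

/-- Causality of the encoder: the variance at `k` uses states before `k`, available because d ≤ 1,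
and the power uses the state at `k - d`. -/
lemma feedbackScale_congr {ξ ξ' : ℕ → Fin m} {k : ℕ}
    (h : ∀ i < k + 1 - csi.delay, ξ i = ξ' i) :
    F.feedbackScale csi Γ ξ k = F.feedbackScale csi Γ ξ' k := by
  have := delay_le_one (csi := csi)
  rw [feedbackScale, feedbackScale, feedbackPower_congr h,
    F.feedbackVar_congr fun i hi => h i (by omega)]

lemma estimatorCoeff_congr {ξ ξ' : ℕ → Fin m} {k : ℕ} (h : ∀ i < k + 1, ξ i = ξ' i) :
    F.estimatorCoeff csi Γ ξ k = F.estimatorCoeff csi Γ ξ' k := by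
  rw [estimatorCoeff, estimatorCoeff, h k (by omega),
    F.feedbackScale_congr fun i hi => h i (by omega), F.feedbackVar_congr fun i hi => h i (by omega),
    feedbackPower_congr fun i hi => h i (by omega)]

/-- Continuation of a finite sequence of states by a constant. -/
def padStates {n : ℕ} (i₀ : Fin m) (x : Fin n → Fin m) (i : ℕ) : Fin m :=
  if h : i < n then x ⟨i, h⟩ else i₀

lemma padStates_of_lt {n : ℕ} (i₀ : Fin m) (x : Fin n → Fin m) {i : ℕ} (h : i < n) :
    padStates i₀ x i = x ⟨i, h⟩ := dif_pos h

variable (csi Γ)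

/-- The Schalkwijk–Kailath code: the transmitter sends the amplified error of the receiver's linear
estimate of the point `w / M`. -/
noncomputable def schalkwijkKailath (i₀ : Fin m) (M K : ℕ) (hM : 0 < M) :
    FeedbackCode m csi M K where
  enc k w y x := F.feedbackScale csi Γ (padStates i₀ x) k *
    ((w : ℝ) / M - ∑ i : Fin k, F.estimatorCoeff csi Γ (padStates i₀ x) i * y i)
  measurable_enc k w x := by fun_prop
  dec y x := nearestMessage hM
    (∑ i : Fin (K + 1), F.estimatorCoeff csi Γ (padStates i₀ x) i * y i)
  measurable_dec x := (measurable_nearestMessage hM).comp (by fun_prop)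

variable (i₀ : Fin m) (M K : ℕ) (hM : 0 < M)

/-- The estimation error of the Schalkwijk–Kailath code before time `k`. -/
noncomputable def estimationError (w : Fin M) (x : Fin (K + 1) → Fin m) (z : Fin (K + 1) → ℝ)
    (k : ℕ) (hk : k ≤ K + 1) : ℝ :=
  (w : ℝ) / M - ∑ i : Fin k, F.estimatorCoeff csi Γ (padStates i₀ x) i *
    F.output (F.schalkwijkKailath csi Γ i₀ M K hM) w x z i (i.2.trans_le hk)

variable {csi Γ i₀ M K hM}

/-- The encoder pads a shorter state sequence than the decoder, but the two paddings agree at all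
times that enter the scale at `k` and the coefficients before `k`. -/
lemma input_schalkwijkKailath (w : Fin M) (x : Fin (K + 1) → Fin m) (z : Fin (K + 1) → ℝ)
    (k : Fin (K + 1)) :
    F.input (F.schalkwijkKailath csi Γ i₀ M K hM) w x z k =
      F.feedbackScale csi Γ (padStates i₀ x) k *
        F.estimationError csi Γ i₀ M K hM w x z k k.2.le := by
  have hd := delay_le_one (csi := csi)
  have hpad : ∀ i < (k : ℕ) + 1 - csi.delay,
      padStates i₀ (fun i : Fin (k + 1 - csi.delay) =>
        x ⟨i, lt_of_lt_of_le i.2 ((Nat.sub_le _ _).trans k.2)⟩) i = padStates i₀ x i := by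
    intro i hi
    have := k.2
    rw [padStates_of_lt _ _ hi, padStates_of_lt _ _ (by omega)]
  rw [input, estimationError]
  simp only [schalkwijkKailath]
  rw [F.feedbackScale_congr hpad]
  congr 2
  refine Finset.sum_congr rfl fun i _ => ?_
  rw [F.estimatorCoeff_congr fun j hj => hpad j (by have := i.2; omega)]

lemma measurable_estimationError (w : Fin M) (x : Fin (K + 1) → Fin m) (k : ℕ) (hk : k ≤ K + 1) :
    Measurable fun z => F.estimationError csi Γ i₀ M K hM w x z k hk :=
  measurable_const.sub (Finset.measurable_sum _ fun _ _ =>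
    (F.measurable_output _ w x _ _).const_mul _)

lemma estimationError_congr (w : Fin M) (x : Fin (K + 1) → Fin m) (k : ℕ) (hk : k ≤ K + 1)
    {z z' : Fin (K + 1) → ℝ} (h : ∀ i : Fin (K + 1), (i : ℕ) < k → z i = z' i) :
    F.estimationError csi Γ i₀ M K hM w x z k hk =
      F.estimationError csi Γ i₀ M K hM w x z' k hk := by
  rw [estimationError, estimationError]
  congr 1
  refine Finset.sum_congr rfl fun i _ => ?_
  rw [F.output_congr _ w i _ (fun _ _ => rfl) fun j hj => h j (hj.trans_lt i.2)]

/-- `estimatorCoeff` is the optimal linear coefficient for an error of variance `feedbackVar`, so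
the old error shrinks by the factor 1 / (1 + S²γ) and fresh noise is added. -/
lemma estimationError_succ (hΓ : ∀ i, 0 ≤ Γ i) (w : Fin M) (x : Fin (K + 1) → Fin m)
    (z : Fin (K + 1) → ℝ) (k : ℕ) (hk : k < K + 1) :
    F.estimationError csi Γ i₀ M K hM w x z (k + 1) hk =
      (1 + F.gain (padStates i₀ x k) ^ 2 * feedbackPower csi Γ (padStates i₀ x) k)⁻¹ *
        F.estimationError csi Γ i₀ M K hM w x z k hk.le +
      -F.estimatorCoeff csi Γ (padStates i₀ x) k * z ⟨k, hk⟩ := by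
  set ξ := padStates i₀ x
  have hs := F.one_add_feedbackPower_pos (csi := csi) hΓ ξ k
  have hv := F.feedbackVar_pos (csi := csi) hΓ ξ k
  have hsq : F.feedbackScale csi Γ ξ k ^ 2 * F.feedbackVar csi Γ ξ k =
      feedbackPower csi Γ ξ k := by
    rw [feedbackScale, Real.sq_sqrt (div_nonneg (feedbackPower_nonneg hΓ ξ k) hv.le),
      div_mul_cancel₀ _ hv.ne']
  have hrec : F.estimationError csi Γ i₀ M K hM w x z (k + 1) hk =
      F.estimationError csi Γ i₀ M K hM w x z k hk.le - F.estimatorCoeff csi Γ ξ k *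
        F.output (F.schalkwijkKailath csi Γ i₀ M K hM) w x z k hk := by
    rw [estimationError, estimationError, Fin.sum_univ_castSucc, sub_sub]
    rfl
  have hx : F.gain (x ⟨k, hk⟩) = F.gain (ξ k) := by
    simp only [ξ, padStates_of_lt i₀ x hk]
  rw [hrec, output_eq, input_schalkwijkKailath, hx]
  have hc : F.estimatorCoeff csi Γ ξ k * F.gain (ξ k) * F.feedbackScale csi Γ ξ k =
      1 - (1 + F.gain (ξ k) ^ 2 * feedbackPower csi Γ ξ k)⁻¹ := by
    rw [estimatorCoeff, eq_sub_iff_add_eq, ← hsq]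
    rw [← hsq] at hs
    field_simp
    ring
  linear_combination (-F.estimationError csi Γ i₀ M K hM w x z k hk.le) * hc

/-- The estimation error of the Schalkwijk–Kailath code decreases at the optimal rate. -/
lemma estimationError_memLp_and_le (hΓ : ∀ i, 0 ≤ Γ i) (w : Fin M) (x : Fin (K + 1) → Fin m)
    (k : ℕ) (hk : k ≤ K + 1) :
    MemLp (fun z => F.estimationError csi Γ i₀ M K hM w x z k hk) 2 (noiseLaw (K + 1)) ∧
    ∫ z, F.estimationError csi Γ i₀ M K hM w x z k hk ^ 2 ∂(noiseLaw (K + 1)) ≤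
      F.feedbackVar csi Γ (padStates i₀ x) k := by
  induction k with
  | zero =>
    have h0 : ∀ z, F.estimationError csi Γ i₀ M K hM w x z 0 hk = (w : ℝ) / M := by
      intro z; simp [estimationError]
    simp only [h0]
    refine ⟨memLp_const _, ?_⟩
    have hM' : (0 : ℝ) < M := by exact_mod_cast hM
    -- The initial error is the point w / M itself, whence the starting value 1 of `feedbackVar`.
    have h1 : (w : ℝ) / M ≤ 1 := by
      rw [div_le_one hM']; exact_mod_cast w.2.le
    have h2 : 0 ≤ (w : ℝ) / M := by positivity
    simp only [integral_const, probReal_univ, one_smul, feedbackVar]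
    nlinarith
  | succ k ih =>
    obtain ⟨hL, hle⟩ := ih (by omega)
    set ξ := padStates i₀ x
    have hk' : k < K + 1 := hk
    have hs := F.one_add_feedbackPower_pos (csi := csi) hΓ ξ k
    have hv := F.feedbackVar_pos (csi := csi) hΓ ξ k
    simp only [F.estimationError_succ hΓ w x _ k hk']
    refine ⟨(hL.const_mul _).add ((memLp_noise _).const_mul _), ?_⟩
    rw [integral_sq_add_noise ⟨k, hk'⟩ (F.measurable_estimationError w x k _)
      (fun z z' h => F.estimationError_congr w x k _ fun i hi => h i (Fin.lt_def.2 hi)) hL]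
    have hc : (-F.estimatorCoeff csi Γ ξ k) ^ 2 = F.gain (ξ k) ^ 2 * feedbackPower csi Γ ξ k *
        F.feedbackVar csi Γ ξ k *
          ((1 + F.gain (ξ k) ^ 2 * feedbackPower csi Γ ξ k)⁻¹) ^ 2 := by
      have hsq : F.feedbackScale csi Γ ξ k ^ 2 =
          feedbackPower csi Γ ξ k / F.feedbackVar csi Γ ξ k := by
        rw [feedbackScale, Real.sq_sqrt (div_nonneg (feedbackPower_nonneg hΓ ξ k) hv.le)]
      rw [neg_sq, estimatorCoeff, div_pow, mul_pow, mul_pow, hsq]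
      field_simp
    rw [hc, feedbackVar]
    -- Old error and noise contribute variance times (1 + S²γ)⁻² and S²γ (1 + S²γ)⁻²; together the
    -- factor is (1 + S²γ)⁻¹.
    calc _ ≤ ((1 + F.gain (ξ k) ^ 2 * feedbackPower csi Γ ξ k)⁻¹) ^ 2 * F.feedbackVar csi Γ ξ k +
          F.gain (ξ k) ^ 2 * feedbackPower csi Γ ξ k * F.feedbackVar csi Γ ξ k *
            ((1 + F.gain (ξ k) ^ 2 * feedbackPower csi Γ ξ k)⁻¹) ^ 2 := by gcongr
      _ = _ := by field_simp

/-- The squared scale is power over error variance, so on each path the input power is at most the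
allocated one; its stationary mean is within budget at every time. Where no state is known yet,
nothing is sent. -/
lemma powerConstraint_schalkwijkKailath {P : ℝ} (hΓ : Γ ∈ F.powerAllocations P) :
    F.PowerConstraint (F.schalkwijkKailath csi Γ i₀ M K hM) P := by
  rw [PowerConstraint, ENNReal.div_le_iff (by simp) (by simp)]
  have hM0 : (M : ℝ≥0∞) ≠ 0 := by exact_mod_cast hM.ne'
  have hP : 0 ≤ P := (Finset.sum_nonneg fun i _ =>
    mul_nonneg (F.stat_nonneg i) (hΓ.1 i)).trans hΓ.2
  calc _ ≤ ∑ k : Fin (K + 1), ENNReal.ofReal P := by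
        refine Finset.sum_le_sum fun k _ => ?_
        rw [F.lintegral_law M K (H := fun ω => ENNReal.ofReal (F.input
          (F.schalkwijkKailath csi Γ i₀ M K hM) ω.1 ω.2.1 ω.2.2 k ^ 2))
          fun w x => ((F.measurable_input _ w x k).pow_const 2).ennreal_ofReal]
        have hw : ∀ w x, ∫⁻ z, ENNReal.ofReal (F.input
            (F.schalkwijkKailath csi Γ i₀ M K hM) w x z k ^ 2) ∂(noiseLaw (K + 1)) ≤
            ENNReal.ofReal (feedbackPower csi Γ (padStates i₀ x) k) := by
          intro w x
          obtain ⟨hL, hle⟩ := F.estimationError_memLp_and_le (csi := csi) (i₀ := i₀) (hM := hM)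
            hΓ.1 w x k k.2.le
          have hv := F.feedbackVar_pos (csi := csi) hΓ.1 (padStates i₀ x) k
          have ha := feedbackPower_nonneg (csi := csi) hΓ.1 (padStates i₀ x) k
          simp only [input_schalkwijkKailath, mul_pow]
          rw [← ofReal_integral_eq_lintegral_ofReal (hL.integrable_sq.const_mul _)
            (ae_of_all _ fun z => by positivity), integral_const_mul]
          refine ENNReal.ofReal_le_ofReal ?_
          rw [feedbackScale, Real.sq_sqrt (div_nonneg ha hv.le)]
          calc _ ≤ feedbackPower csi Γ (padStates i₀ x) k / F.feedbackVar csi Γ (padStates i₀ x) k *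
                F.feedbackVar csi Γ (padStates i₀ x) k := by gcongr
            _ = _ := div_mul_cancel₀ _ hv.ne'
        calc _ ≤ ∑ x, ENNReal.ofReal (F.pathProb K x) * ((M : ℝ≥0∞)⁻¹ * ∑ w : Fin M,
              ENNReal.ofReal (feedbackPower csi Γ (padStates i₀ x) k)) := by
              gcongr with x _ w _
              exact hw w x
          _ = ∑ x, ENNReal.ofReal (F.pathProb K x * feedbackPower csi Γ (padStates i₀ x) k) := by
              refine Finset.sum_congr rfl fun x _ => ?_
              rw [Finset.sum_const, Finset.card_univ, Fintype.card_fin, nsmul_eq_mul,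
                ← mul_assoc (M : ℝ≥0∞)⁻¹, ENNReal.inv_mul_cancel hM0 (by simp), one_mul,
                ENNReal.ofReal_mul (F.pathProb_nonneg K x)]
          _ = ENNReal.ofReal (∑ x, F.pathProb K x *
              feedbackPower csi Γ (padStates i₀ x) k) := by
              rw [ENNReal.ofReal_sum_of_nonneg fun x _ =>
                mul_nonneg (F.pathProb_nonneg K x) (feedbackPower_nonneg hΓ.1 _ _)]
          _ ≤ _ := by
              refine ENNReal.ofReal_le_ofReal ?_
              by_cases hk : csi.delay ≤ k
              · have : ∀ x : Fin (K + 1) → Fin m, feedbackPower csi Γ (padStates i₀ x) k =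
                    Γ (x (delayedTime csi k)) := by
                  intro x
                  rw [feedbackPower, if_pos hk, padStates_of_lt]
                  rfl
                simp only [this, F.sum_pathProb_apply]
                exact hΓ.2
              · simp [feedbackPower, hk, hP]
    _ = _ := by simp [mul_comm]

/-- The points w / M have spacing 1 / M, so decoding succeeds when the final error is below 1 / (2
M); Chebyshev's inequality gives the factor 4 M². -/
lemma condErrorProb_schalkwijkKailath_le (hΓ : ∀ i, 0 ≤ Γ i) (w : Fin M)
    (x : Fin (K + 1) → Fin m) :
    F.condErrorProb (F.schalkwijkKailath csi Γ i₀ M K hM) w x ≤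
      4 * (M : ℝ) ^ 2 * F.feedbackVar csi Γ (padStates i₀ x) (K + 1) := by
  have hM' : (0 : ℝ) < M := by exact_mod_cast hM
  obtain ⟨hL, hle⟩ := F.estimationError_memLp_and_le (csi := csi) (i₀ := i₀) (hM := hM)
    hΓ w x (K + 1) le_rfl
  have hmarkov := mul_meas_ge_le_integral_of_nonneg (ae_of_all _ fun z => sq_nonneg
    (F.estimationError csi Γ i₀ M K hM w x z (K + 1) le_rfl)) hL.integrable_sq
    ((1 / (2 * (M : ℝ))) ^ 2)
  have hsub : F.condErrorProb (F.schalkwijkKailath csi Γ i₀ M K hM) w x ≤ (noiseLaw (K + 1)).real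
      {z | (1 / (2 * (M : ℝ))) ^ 2 ≤
        F.estimationError csi Γ i₀ M K hM w x z (K + 1) le_rfl ^ 2} := by
    refine measureReal_mono ?_ (measure_ne_top _ _)
    intro z hz
    by_contra hlt
    refine hz (nearestMessage_eq hM ?_)
    have h2 : F.estimationError csi Γ i₀ M K hM w x z (K + 1) le_rfl ^ 2 <
      (1 / (2 * (M : ℝ))) ^ 2 := not_le.1 hlt
    exact abs_lt_of_sq_lt_sq h2 (by positivity)
  have h3 : (1 / (2 * (M : ℝ))) ^ 2 *
      F.condErrorProb (F.schalkwijkKailath csi Γ i₀ M K hM) w x ≤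
        F.feedbackVar csi Γ (padStates i₀ x) (K + 1) :=
    (mul_le_mul_of_nonneg_left hsub (by positivity)).trans (hmarkov.trans hle)
  calc _ = 4 * (M : ℝ) ^ 2 * ((1 / (2 * (M : ℝ))) ^ 2 *
        F.condErrorProb (F.schalkwijkKailath csi Γ i₀ M K hM) w x) := by field_simp; norm_num
    _ ≤ _ := by gcongr

/-- Twice the gain in rate of a transition from state `i` to state `j`. -/
noncomputable def transitionRate (F : GaussianFSMC m) (Γ : Fin m → ℝ) : CSI → Fin m → Fin m → ℝ
  | .instantaneous, i, _ => Real.log (1 + F.gain i ^ 2 * Γ i)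
  | .delayed, i, j => Real.log (1 + F.gain j ^ 2 * Γ i)

lemma sum_transitionRate (csi : CSI) (Γ : Fin m → ℝ) :
    ∑ i, F.stat i * ∑ j, F.trans i j * F.transitionRate Γ csi i j =
      2 * F.allocationRate csi Γ := by
  rw [allocationRate, ← mul_assoc]
  norm_num
  refine Finset.sum_congr rfl fun i _ => ?_
  cases csi with
  | instantaneous =>
    simp only [transitionRate, pairProb, CSI.delay, pow_zero, ← Finset.sum_mul, F.sum_trans]
    rw [Finset.sum_eq_single i (fun j _ hj => by simp [Matrix.one_apply_ne' hj]) (by simp)]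
    simp
  | delayed =>
    simp only [transitionRate, pairProb, CSI.delay, pow_one, Finset.mul_sum, mul_assoc]

/-- K + 1 channel uses are matched with K transitions by dropping one nonnegative logarithm: the
last for instantaneous information, the first, where no power is spent, for delayed information. -/
lemma feedbackVar_le (hΓ : ∀ i, 0 ≤ Γ i) (x : Fin (K + 1) → Fin m) :
    F.feedbackVar csi Γ (padStates i₀ x) (K + 1) ≤
      Real.exp (-∑ k : Fin K, F.transitionRate Γ csi (x k.castSucc) (x k.succ)) := by
  rw [F.feedbackVar_eq_exp hΓ, Real.exp_le_exp, neg_le_neg_iff]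
  have hpad : ∀ k : Fin (K + 1), padStates i₀ x k = x k := fun k => padStates_of_lt _ _ k.2
  have hlog : ∀ k, 0 ≤ Real.log (1 + F.gain (padStates i₀ x k) ^ 2 *
      feedbackPower csi Γ (padStates i₀ x) k) := fun k => by
    refine Real.log_nonneg ?_
    have := mul_nonneg (sq_nonneg (F.gain (padStates i₀ x k)))
      (feedbackPower_nonneg (csi := csi) hΓ (padStates i₀ x) k)
    linarith
  cases csi with
  | instantaneous =>
    rw [Fin.sum_univ_castSucc]
    refine le_add_of_le_of_nonneg (le_of_eq (Finset.sum_congr rfl fun k _ => ?_)) (hlog _)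
    have h1 := hpad k.castSucc
    simp only [Fin.val_castSucc] at h1
    simp [feedbackPower, CSI.delay, transitionRate, h1]
  | delayed =>
    rw [Fin.sum_univ_succ]
    refine le_add_of_nonneg_of_le (hlog _) (le_of_eq (Finset.sum_congr rfl fun k _ => ?_))
    have h1 := hpad k.castSucc
    have h2 := hpad k.succ
    simp only [Fin.val_castSucc] at h1
    simp only [Fin.val_succ] at h2
    simp [feedbackPower, CSI.delay, transitionRate, h1, h2]

/-- The error probability of the Schalkwijk–Kailath code. -/
lemma errorProb_schalkwijkKailath_le (hΓ : ∀ i, 0 ≤ Γ i) {A : ℝ} {δ : ℝ} (hδ : 0 < δ)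
    (hK : 0 < K) (hA : ∑ x, F.pathProb K x * (∑ k : Fin K,
      (F.transitionRate Γ csi (x k.castSucc) (x k.succ) - 2 * F.allocationRate csi Γ)) ^ 2 ≤
        A * (K + 1)) :
    F.errorProb (F.schalkwijkKailath csi Γ i₀ M K hM) ≤ ENNReal.ofReal
      (A * (K + 1) / (K * δ) ^ 2 +
        4 * (M : ℝ) ^ 2 * Real.exp (-(K * (2 * F.allocationRate csi Γ - δ)))) := by
  have hM' : (0 : ℝ) < M := by exact_mod_cast hM
  have hK' : (0 : ℝ) < K := by exact_mod_cast hK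
  set C := F.allocationRate csi Γ
  rw [errorProb_eq]
  refine ENNReal.ofReal_le_ofReal ?_
  set E := 4 * (M : ℝ) ^ 2 * Real.exp (-(K * (2 * C - δ)))
  have hE : 0 ≤ E := by positivity
  let D : (Fin (K + 1) → Fin m) → ℝ := fun x => ∑ k : Fin K,
    (F.transitionRate Γ csi (x k.castSucc) (x k.succ) - 2 * C)
  -- Chebyshev's inequality in pointwise form: where the functional deviates by at least K δ the
  -- first term is at least 1, and elsewhere the error variance is exponentially small.
  have hpt : ∀ w x, F.condErrorProb (F.schalkwijkKailath csi Γ i₀ M K hM) w x ≤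
      D x ^ 2 / (K * δ) ^ 2 + E := by
    intro w x
    by_cases hx : (K * δ) ^ 2 ≤ D x ^ 2
    · have h1 : 1 ≤ D x ^ 2 / (K * δ) ^ 2 := by rwa [one_le_div (by positivity)]
      have h2 : F.condErrorProb (F.schalkwijkKailath csi Γ i₀ M K hM) w x ≤ 1 :=
        measureReal_le_one
      linarith
    · have h1 : |D x| < K * δ := abs_lt_of_sq_lt_sq (not_le.1 hx) (by positivity)
      have h2 := (abs_lt.1 h1).1
      have h3 : D x = ∑ k : Fin K, F.transitionRate Γ csi (x k.castSucc) (x k.succ) -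
          K * (2 * C) := by
        simp [D, Finset.sum_sub_distrib]
      have h4 : F.feedbackVar csi Γ (padStates i₀ x) (K + 1) ≤
          Real.exp (-(K * (2 * C - δ))) := by
        refine (F.feedbackVar_le hΓ x).trans (Real.exp_le_exp.2 ?_)
        linarith
      calc _ ≤ 4 * (M : ℝ) ^ 2 * F.feedbackVar csi Γ (padStates i₀ x) (K + 1) :=
            F.condErrorProb_schalkwijkKailath_le hΓ w x
        _ ≤ E := mul_le_mul_of_nonneg_left h4 (by positivity)
        _ ≤ _ := le_add_of_nonneg_left (by positivity)
  calc _ ≤ ∑ x, F.pathProb K x * (D x ^ 2 / (K * δ) ^ 2 + E) := by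
        refine Finset.sum_le_sum fun x _ => mul_le_mul_of_nonneg_left ?_ (F.pathProb_nonneg K x)
        calc _ ≤ (M : ℝ)⁻¹ * ∑ w : Fin M, (D x ^ 2 / (K * δ) ^ 2 + E) :=
              mul_le_mul_of_nonneg_left (Finset.sum_le_sum fun w _ => hpt w x) (by positivity)
          _ = _ := by
              rw [Finset.sum_const, Finset.card_univ, Fintype.card_fin, nsmul_eq_mul]
              field_simp
    _ = (∑ x, F.pathProb K x * D x ^ 2) / (K * δ) ^ 2 + E := by
        simp only [mul_add, Finset.sum_add_distrib, ← Finset.sum_mul, F.sum_pathProb, one_mul,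
          Finset.sum_div, mul_div_assoc]
    _ ≤ _ := by gcongr

/-- Achievability: all rates below the rate of a feasible power allocation are achievable. -/
lemma achievable_of_lt_allocationRate (csi : CSI) {P R : ℝ} (hΓ : Γ ∈ F.powerAllocations P)
    (hR : R < F.allocationRate csi Γ) : F.Achievable csi P R := by
  obtain ⟨i₀⟩ := F.nonempty_states
  set C := F.allocationRate csi Γ
  have hM : ∀ K : ℕ, 0 < ⌈Real.exp (((K : ℝ) + 1) * R)⌉₊ := fun K => Nat.ceil_pos.2 (Real.exp_pos _)
  refine ⟨fun K => ⌈Real.exp (((K : ℝ) + 1) * R)⌉₊,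
    fun K => F.schalkwijkKailath csi Γ i₀ _ K (hM K),
    fun K => F.powerConstraint_schalkwijkKailath hΓ, ?_, ?_⟩
  · refine le_liminf_of_le (by isBoundedDefault) (Eventually.of_forall fun K => ?_)
    have hK : (0 : ℝ) < (K : ℝ) + 1 := by positivity
    rw [EReal.coe_le_coe_iff, le_div_iff₀ hK, mul_comm,
      Real.le_log_iff_exp_le (by exact_mod_cast hM K)]
    exact Nat.le_ceil _
  -- For R ≤ 0 there is a single message, and no error is possible.
  · rcases le_or_gt R 0 with hR0 | hR0
    · refine tendsto_const_nhds.congr fun K => ?_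
      have h1 : ⌈Real.exp (((K : ℝ) + 1) * R)⌉₊ ≤ 1 := by
        rw [Nat.ceil_le, Nat.cast_one, Real.exp_le_one_iff]
        exact mul_nonpos_of_nonneg_of_nonpos (by positivity) hR0
      have : Subsingleton (Fin ⌈Real.exp (((K : ℝ) + 1) * R)⌉₊) := by
        rwa [Fin.subsingleton_iff_le_one]
      rw [errorProb]
      have : ∀ a b : Fin ⌈Real.exp (((K : ℝ) + 1) * R)⌉₊, ¬ a ≠ b := fun a b h =>
        h (Subsingleton.elim a b)
      simp [this]
    · obtain ⟨A, hA0, hA⟩ := F.exists_additive_functional_sq_le (F.transitionRate Γ csi)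
      simp only [F.sum_transitionRate] at hA
      -- With δ = C − R the variance exponent is 2C − δ = C + R per step, against 2R from M². The
      -- factor 16 e^{2R} comes from M ≤ 2 e^{(K+1)R} and the one extra time step.
      have hδ : 0 < C - R := sub_pos.2 hR
      have hcast : Tendsto (fun K : ℕ => (K : ℝ)) atTop atTop := tendsto_natCast_atTop_atTop
      have t1 : Tendsto (fun K : ℕ => 2 * A / (C - R) ^ 2 / (K : ℝ)) atTop (𝓝 0) :=
        hcast.const_div_atTop _
      have t2 : Tendsto (fun K : ℕ => 16 * Real.exp (2 * R) * Real.exp (-((K : ℝ) * (C - R))))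
          atTop (𝓝 0) := by
        have h := (Real.tendsto_exp_neg_atTop_nhds_zero.comp
          (hcast.atTop_mul_const hδ)).const_mul (16 * Real.exp (2 * R))
        rwa [mul_zero] at h
      have t3 := ENNReal.tendsto_ofReal (t1.add t2)
      rw [add_zero, ENNReal.ofReal_zero] at t3
      refine tendsto_of_tendsto_of_tendsto_of_le_of_le' tendsto_const_nhds t3
        (Eventually.of_forall fun _ => zero_le) ?_
      filter_upwards [eventually_ge_atTop 1] with K hK
      refine (F.errorProb_schalkwijkKailath_le hΓ.1 hδ hK (hA K)).trans
        (ENNReal.ofReal_le_ofReal ?_)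
      have hK' : (1 : ℝ) ≤ K := by exact_mod_cast hK
      set X := Real.exp (((K : ℝ) + 1) * R)
      have hX : 1 ≤ X := Real.one_le_exp (by positivity)
      have hceil : (⌈X⌉₊ : ℝ) ≤ 2 * X := by
        have := Nat.ceil_lt_add_one (zero_le_one.trans hX)
        linarith
      have b1 : A * ((K : ℝ) + 1) / (K * (C - R)) ^ 2 ≤ 2 * A / (C - R) ^ 2 / K := by
        rw [div_div, div_le_div_iff₀ (by positivity) (by positivity)]
        have : A * ((K : ℝ) + 1) ≤ 2 * A * K := by nlinarith
        calc _ ≤ 2 * A * K * ((C - R) ^ 2 * K) := by gcongr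
          _ = _ := by ring
      have b2 : 4 * (⌈X⌉₊ : ℝ) ^ 2 * Real.exp (-(K * (2 * C - (C - R)))) ≤
          16 * Real.exp (2 * R) * Real.exp (-((K : ℝ) * (C - R))) := by
        calc _ ≤ 4 * (2 * X) ^ 2 * Real.exp (-(K * (2 * C - (C - R)))) := by gcongr
          _ = 16 * (X * X * Real.exp (-(K * (2 * C - (C - R))))) := by ring
          _ = 16 * (Real.exp (2 * R) * Real.exp (-((K : ℝ) * (C - R)))) := by
              rw [← Real.exp_add, ← Real.exp_add, ← Real.exp_add]
              congr 2
              ring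
          _ = _ := by ring
      exact add_le_add b1 b2

end GaussianFSMC

/-! ### Both capacities identified -/

namespace GaussianFSMC

variable {m : ℕ} (F : GaussianFSMC m)

/-- The lower bound is a limit from below: only rates strictly under that of Γ are shown achievable,
which suffices for a supremum. -/
lemma operationalCapacity_eq {csi : CSI} {P : ℝ} (hP : 0 ≤ P) {Γ : Fin m → ℝ}
    (hΓ : F.IsOptimalAllocation csi P Γ) :
    F.operationalCapacity csi P = (F.allocationRate csi Γ : EReal) := by
  refine le_antisymm (sSup_le ?_) (EReal.ge_of_forall_gt_iff_ge.1 fun R hR => ?_)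
  · rintro _ ⟨R, hR, rfl⟩
    exact EReal.coe_le_coe_iff.2 (Achievable.le_allocationRate F hP hΓ hR)
  · exact le_sSup ⟨R, F.achievable_of_lt_allocationRate csi hΓ.1 (EReal.coe_lt_coe_iff.1 hR), rfl⟩

end GaussianFSMC

theorem theorem1 {m : ℕ} (F : GaussianFSMC m) (csi : CSI) (P : ℝ) (hP : 0 ≤ P) :
    F.operationalCapacity csi P = (F.informationCapacity csi P : EReal) ∧
    F.informationCapacity csi P ∈ F.informationRates csi P ∧
    (∃ Γ : Fin m → ℝ, F.IsOptimalAllocation csi P Γ) ∧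
    ∀ Γ : Fin m → ℝ, F.IsOptimalAllocation csi P Γ →
      (F.informationCapacity csi P : EReal) = ((Real.log (F.aTilde csi Γ) : ℝ) : EReal) := by
  have hcap : ∀ Γ : Fin m → ℝ, F.IsOptimalAllocation csi P Γ →
      (F.informationCapacity csi P : EReal) = (F.allocationRate csi Γ : EReal) := by
    intro Γ hΓ
    rw [GaussianFSMC.informationCapacity, (F.isGreatest_informationRates hP hΓ).csSup_eq,
      EReal.coe_ennreal_ofReal, max_eq_left (F.allocationRate_nonneg csi hΓ.1.1)]
  obtain ⟨Γ, hΓ⟩ := F.exists_isOptimalAllocation csi hP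
  refine ⟨?_, ?_, ⟨Γ, hΓ⟩, fun Γ' hΓ' => ?_⟩
  · rw [hcap Γ hΓ, F.operationalCapacity_eq hP hΓ]
  · have h := F.isGreatest_informationRates hP hΓ
    rw [GaussianFSMC.informationCapacity, h.csSup_eq]
    exact h.1
  · rw [hcap Γ' hΓ', F.log_aTilde csi Γ' hΓ'.1.1]
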